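/- The SDN synchronization problem (Obj. 1) is the following. Given $C$ controllers, a maximum rate $R\in\mathbb{N}$, rates of state change $\lambda_i\ge 0$, a slot length $s>0$, message costs $b_{ij}\ge 0$ ($i\ne j$) and a budget $B>0$, choose $x_{ij}\in\{0,1,\dots,R\}$ for all ordered pairs $i\neq j$ so as to maximize the consistency level $$\Omega(x)=\sum_{i}\sum_{j\ne i}e^{-\lambda_i s/(x_{ij}+1)}\qquad\text{subject to}\qquad \sum_i\sum_{j\ne i}x_{ij}b_{ij}\le B .$$ Algorithms are programs for a real RAM: an arithmetic operation, exponentiation or comparison on real numbers takes one unit of time, an operation on nonnegative integers takes time proportional to the binary length of its operands, and real numbers cannot be rounded to integers. The length of the input is the number of its real entries $\lambda_i,b_{ij},s,B$ plus the binary lengths of the integers $C$ and $R$. (1) There is a pseudopolynomial-time optimal algorithm: a program which, for every instance in which all $b_{ij}$ and $B$ are integers, outputs an optimal policy $x$, in time polynomial in the input length and in the numerical values of $R$ and $B$. (2) There is a fully polynomial-time approximation (FPTA) algorithm: a program which, for every instance and every $\epsilon\in(0,1)$ given as an additional input, outputs a feasible policy $x$ with $\Omega(x)\ge(1-\epsilon)\max_y\Omega(y)$,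 where $y$ ranges over the feasible policies, in time polynomial in the input length and $1/\epsilon$. -/

import Mathlib

/-! ## The synchronization problem -/

/-- An instance of the synchronization problem with `C` controllers: maximum rate `R`,
rates of state change `lam i`, slot length `s`, message costs `b i j` and budget `B`.
The diagonal entries `b i i` play no role. -/
structure SyncInstance where
  C : ℕ
  R : ℕ
  lam : Fin C → ℝ
  s : ℝ
  b : Fin C → Fin C → ℝ
  B : ℝ
  lam_nonneg : ∀ i, 0 ≤ lam i
  s_pos : 0 < s
  b_nonneg : ∀ i j, j ≠ i → 0 ≤ b i j
  B_pos : 0 < B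

namespace SyncInstance

/-- A policy: the number of messages from `i` to `j` (the diagonal is ignored). -/
abbrev Policy (I : SyncInstance) : Type := Fin I.C → Fin I.C → ℕ

/-- All rates are at most `R` and the total cost is at most `B`. -/
def Feasible (I : SyncInstance) (x : I.Policy) : Prop :=
  (∀ i j, j ≠ i → x i j ≤ I.R) ∧
    ∑ i, ∑ j with j ≠ i, (x i j : ℝ) * I.b i j ≤ I.B

/-- The consistency level of a policy. -/
noncomputable def consistencyLevel (I : SyncInstance) (x : I.Policy) : ℝ :=
  ∑ i, ∑ j with j ≠ i, Real.exp (-(I.lam i * I.s / ((x i j : ℝ) + 1)))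

/-- The costs and the budget are integers. -/
def IsIntegral (I : SyncInstance) : Prop :=
  (∀ i j, j ≠ i → ∃ n : ℕ, I.b i j = n) ∧ ∃ n : ℕ, I.B = n

/-- The length of the input: the number of real inputs (`lam`, `b`, `s`, `B`)
plus the binary lengths of the two integer inputs `C` and `R`. -/
def inputSize (I : SyncInstance) : ℕ :=
  (I.C + I.C * I.C + 2) + Nat.size I.C + Nat.size I.R

end SyncInstance

/-! ## The machine model: while programs on a real RAM

The memory consists of integer arrays and real arrays, named by natural numbers that are fixed in
the program and indexed by computed natural numbers. Integer operations are charged the binary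
length of their operands; `+`, `-`, `*`, `/`, `exp` and `≤` on reals are charged one unit.
Integers may be converted to reals, but there is no conversion (rounding) from reals to integers,
and real constants arise only from integers. -/

namespace RealRAM

/-- A memory: `nats a k` and `reals a k` are the entries at index `k` of the arrays named `a`. -/
structure State where
  nats : ℕ → ℕ → ℕ
  reals : ℕ → ℕ → ℝ

def State.setNat (σ : State) (a k v : ℕ) : State :=
  { σ with nats := Function.update σ.nats a (Function.update (σ.nats a) k v) }

def State.setReal (σ : State) (a k : ℕ) (v : ℝ) : State :=
  { σ with reals := Function.update σ.reals a (Function.update (σ.reals a) k v) }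

/-- Integer expressions; `sub` is truncated and `div` is rounded down (and `0` for divisor `0`). -/
inductive NatExpr where
  | const (n : ℕ)
  | load (a : ℕ) (k : NatExpr)
  | add (e f : NatExpr)
  | sub (e f : NatExpr)
  | mul (e f : NatExpr)
  | div (e f : NatExpr)

def NatExpr.eval (σ : State) : NatExpr → ℕ
  | const n => n
  | load a k => σ.nats a (k.eval σ)
  | add e f => e.eval σ + f.eval σ
  | sub e f => e.eval σ - f.eval σ
  | mul e f => e.eval σ * f.eval σ
  | div e f => e.eval σ / f.eval σ

/-- Logarithmic cost of the evaluation of an integer expression. -/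
def NatExpr.cost (σ : State) : NatExpr → ℕ
  | const n => 1 + Nat.size n
  | load a k => k.cost σ + (1 + Nat.size (k.eval σ) + Nat.size (σ.nats a (k.eval σ)))
  | add e f => e.cost σ + f.cost σ + (1 + Nat.size (e.eval σ) + Nat.size (f.eval σ))
  | sub e f => e.cost σ + f.cost σ + (1 + Nat.size (e.eval σ) + Nat.size (f.eval σ))
  | mul e f => e.cost σ + f.cost σ + (1 + Nat.size (e.eval σ) + Nat.size (f.eval σ))
  | div e f => e.cost σ + f.cost σ + (1 + Nat.size (e.eval σ) + Nat.size (f.eval σ))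

/-- Real expressions; `div` has the value `0` for divisor `0`. -/
inductive RealExpr where
  | ofNat (e : NatExpr)
  | load (a : ℕ) (k : NatExpr)
  | add (e f : RealExpr)
  | sub (e f : RealExpr)
  | mul (e f : RealExpr)
  | div (e f : RealExpr)
  | exp (e : RealExpr)

noncomputable def RealExpr.eval (σ : State) : RealExpr → ℝ
  | ofNat e => (e.eval σ : ℝ)
  | load a k => σ.reals a (k.eval σ)
  | add e f => e.eval σ + f.eval σ
  | sub e f => e.eval σ - f.eval σ
  | mul e f => e.eval σ * f.eval σ
  | div e f => e.eval σ / f.eval σ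
  | exp e => Real.exp (e.eval σ)

/-- Cost of the evaluation of a real expression: one unit for each operation on reals. -/
def RealExpr.cost (σ : State) : RealExpr → ℕ
  | ofNat e => e.cost σ + (1 + Nat.size (e.eval σ))
  | load _ k => k.cost σ + (1 + Nat.size (k.eval σ))
  | add e f => e.cost σ + f.cost σ + 1
  | sub e f => e.cost σ + f.cost σ + 1
  | mul e f => e.cost σ + f.cost σ + 1
  | div e f => e.cost σ + f.cost σ + 1
  | exp e => e.cost σ + 1

/-- Tests. -/
inductive Test where
  | natLe (e f : NatExpr)
  | realLe (e f : RealExpr)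
  | not (c : Test)
  | and (c d : Test)

def Test.Holds (σ : State) : Test → Prop
  | natLe e f => e.eval σ ≤ f.eval σ
  | realLe e f => e.eval σ ≤ f.eval σ
  | not c => ¬ c.Holds σ
  | and c d => c.Holds σ ∧ d.Holds σ

def Test.cost (σ : State) : Test → ℕ
  | natLe e f => e.cost σ + f.cost σ + (1 + Nat.size (e.eval σ) + Nat.size (f.eval σ))
  | realLe e f => e.cost σ + f.cost σ + 1
  | not c => c.cost σ + 1
  | and c d => c.cost σ + d.cost σ + 1

/-- Programs. -/
inductive Program where
  | skip
  | setNat (a : ℕ) (k e : NatExpr)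
  | setReal (a : ℕ) (k : NatExpr) (e : RealExpr)
  | seq (p q : Program)
  | cond (c : Test) (p q : Program)
  | loop (c : Test) (p : Program)

/-- `Runs p σ τ t`: started in the memory `σ`, the program `p` halts with the memory `τ`
after `t` units of time. -/
inductive Runs : Program → State → State → ℕ → Prop
  | skip (σ : State) : Runs .skip σ σ 1
  | setNat (a : ℕ) (k e : NatExpr) (σ : State) :
      Runs (.setNat a k e) σ (σ.setNat a (k.eval σ) (e.eval σ))
        (k.cost σ + e.cost σ + (1 + Nat.size (k.eval σ) + Nat.size (e.eval σ)))
  | setReal (a : ℕ) (k : NatExpr) (e : RealExpr) (σ : State) :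
      Runs (.setReal a k e) σ (σ.setReal a (k.eval σ) (e.eval σ))
        (k.cost σ + e.cost σ + (1 + Nat.size (k.eval σ)))
  | seq {p q : Program} {σ τ υ : State} {t u : ℕ} :
      Runs p σ τ t → Runs q τ υ u → Runs (.seq p q) σ υ (t + u)
  | condTrue {c : Test} {p q : Program} {σ τ : State} {t : ℕ} :
      c.Holds σ → Runs p σ τ t → Runs (.cond c p q) σ τ (c.cost σ + t + 1)
  | condFalse {c : Test} {p q : Program} {σ τ : State} {t : ℕ} :
      ¬ c.Holds σ → Runs q σ τ t → Runs (.cond c p q) σ τ (c.cost σ + t + 1)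
  | loopFalse {c : Test} {p : Program} {σ : State} :
      ¬ c.Holds σ → Runs (.loop c p) σ σ (c.cost σ + 1)
  | loopTrue {c : Test} {p : Program} {σ τ υ : State} {t u : ℕ} :
      c.Holds σ → Runs p σ τ t → Runs (.loop c p) τ υ u →
        Runs (.loop c p) σ υ (c.cost σ + t + u + 1)

end RealRAM

/-! ## Algorithms for the synchronization problem -/

namespace SyncInstance

/-- The memory in which an algorithm starts. Integer array `0` holds `C, R`; real array `0` holds
`lam`; real array `1` holds the matrix `b` row by row (`b i j` at index `j + C * i`);
real array `2` holds `s, B` and the accuracy `ε`. All other entries are `0`. -/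
noncomputable def inputState (I : SyncInstance) (ε : ℝ) : RealRAM.State where
  nats
    | 0, 0 => I.C
    | 0, 1 => I.R
    | _, _ => 0
  reals
    | 0, k => if h : k < I.C then I.lam ⟨k, h⟩ else 0
    | 1, k => if h : k < I.C * I.C then
        I.b (finProdFinEquiv.symm ⟨k, h⟩).1 (finProdFinEquiv.symm ⟨k, h⟩).2 else 0
    | 2, 0 => I.s
    | 2, 1 => I.B
    | 2, 2 => ε
    | _, _ => 0

/-- The policy that is read off the final memory: `x i j` is at index `j + C * i` of the
integer array `1`. -/
def outputPolicy (I : SyncInstance) (τ : RealRAM.State) : I.Policy :=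
  fun i j => τ.nats 1 (finProdFinEquiv (i, j) : Fin (I.C * I.C))

end SyncInstance

/-- `P` is a pseudopolynomial-time exact algorithm: for integer costs and budget it halts with an
optimal policy, in time polynomial in the input length and the numbers `R` and `B`. -/
def IsPseudopolynomialExactAlgorithm (P : RealRAM.Program) : Prop :=
  ∃ p : Polynomial ℕ, ∀ I : SyncInstance, I.IsIntegral →
    ∃ (τ : RealRAM.State) (t : ℕ),
      RealRAM.Runs P (I.inputState 0) τ t ∧
      t ≤ p.eval (I.inputSize + I.R + ⌊I.B⌋₊) ∧
      I.Feasible (I.outputPolicy τ) ∧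
      ∀ y : I.Policy, I.Feasible y →
        I.consistencyLevel y ≤ I.consistencyLevel (I.outputPolicy τ)

/-- `P` is a fully polynomial-time approximation scheme: for every accuracy `ε ∈ (0, 1)` it halts
with a feasible policy that reaches at least a `(1 - ε)` fraction of the optimum, in time
polynomial in the input length and `1 / ε`. -/
def IsFPTAS (P : RealRAM.Program) : Prop :=
  ∃ p : Polynomial ℕ, ∀ (I : SyncInstance) (ε : ℝ), 0 < ε → ε < 1 →
    ∃ (τ : RealRAM.State) (t : ℕ),
      RealRAM.Runs P (I.inputState ε) τ t ∧
      t ≤ p.eval (I.inputSize + ⌈1 / ε⌉₊) ∧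
      I.Feasible (I.outputPolicy τ) ∧
      ∀ y : I.Policy, I.Feasible y →
        (1 - ε) * I.consistencyLevel y ≤ I.consistencyLevel (I.outputPolicy τ)

/-! Both parts are multiple-choice knapsack problems: every ordered pair of controllers is a class
`m < n = C * C`, diagonal pairs have cost and value zero, and one rate is chosen per class. Since
`R` enters the input only through its binary length, the rates are never enumerated. Values and
costs are monotone in the rate, so the relevant rate for each class and table column is found by
binary search. A min-plus dynamic program then distributes a total `q` of integral units over the
classes, and a traceback recovers the distribution.

Exact algorithm: the units are units of money. Class `m` with `d` units takes the largest rate it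
can afford, and the program minimizes the total negative value. Integrality of the costs makes the
expenses of any feasible policy such a distribution (`Knapsack.exact_optimal`).

Approximation: values cannot be scaled and rounded on this machine. Let `L` be the largest value of
a single affordable item. The units are now deficits of size `L / Q` below `L`: class `m` with
deficit `d` takes the least rate whose value is at least `L - d * (L / Q)`, and the program
minimizes the cost. The least total deficit within the budget is selected. A feasible policy has
deficits whose rounding loses at most one unit per class, so the loss is at most `n * (L / Q)`
(`Knapsack.approx_optimal`). With `Q = ⌈n / ε⌉` this is at most `ε * L`, and `L` does not exceed the
optimum (`State.IsBestSingle.exists_rates`).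

The running time is controlled by a single parameter `S`, which bounds the binary lengths of all
integers in memory and the number of rounds of every loop. A `Spec` has the same `S` before and
after the run, so specifications compose without iterating polynomials. At the end `S` is a
polynomial in the input length and `R + B` or `1 / ε`. -/

namespace RealRAM

/-! ## A relational program logic for polynomial time -/

/-- All integers in the memory have binary length at most `S`. -/
def State.Bdd (σ : State) (S : ℕ) : Prop := ∀ a k, Nat.size (σ.nats a k) ≤ S

theorem size_le_self (n : ℕ) : Nat.size n ≤ n := Nat.size_le.2 n.lt_two_pow_self

theorem size_add_le (m n : ℕ) : Nat.size (m + n) ≤ Nat.size m + Nat.size n + 1 := by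
  rw [Nat.size_le]
  have hm := Nat.lt_size_self m
  have hn := Nat.lt_size_self n
  have h1 : 2 ^ m.size ≤ 2 ^ (m.size + n.size) := Nat.pow_le_pow_right (by norm_num) (by omega)
  have h2 : 2 ^ n.size ≤ 2 ^ (m.size + n.size) := Nat.pow_le_pow_right (by norm_num) (by omega)
  rw [pow_succ]
  omega

theorem size_mul_le (m n : ℕ) : Nat.size (m * n) ≤ Nat.size m + Nat.size n := by
  rw [Nat.size_le, pow_add]
  exact Nat.mul_lt_mul'' (Nat.lt_size_self m) (Nat.lt_size_self n)

/-- The expression is fixed, so only a bounded number of operations takes place, and each of them at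
most adds the lengths of its operands, plus one. Multiplication is harmless for the same reason: it
adds lengths. -/
theorem NatExpr.exists_bound (e : NatExpr) : ∃ c, ∀ (S : ℕ) (σ : State), σ.Bdd S →
    Nat.size (e.eval σ) ≤ c * (S + 1) ∧ e.cost σ ≤ c * (S + 1) := by
  have binary {e f : NatExpr}
      (he : ∃ c, ∀ (S : ℕ) (σ : State), σ.Bdd S →
        Nat.size (e.eval σ) ≤ c * (S + 1) ∧ e.cost σ ≤ c * (S + 1))
      (hf : ∃ c, ∀ (S : ℕ) (σ : State), σ.Bdd S →
        Nat.size (f.eval σ) ≤ c * (S + 1) ∧ f.cost σ ≤ c * (S + 1)) (op : ℕ → ℕ → ℕ)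
      (hop : ∀ m n, Nat.size (op m n) ≤ Nat.size m + Nat.size n + 1) :
      ∃ c, ∀ (S : ℕ) (σ : State), σ.Bdd S →
        Nat.size (op (e.eval σ) (f.eval σ)) ≤ c * (S + 1) ∧
        e.cost σ + f.cost σ + (1 + Nat.size (e.eval σ) + Nat.size (f.eval σ)) ≤ c * (S + 1) := by
    obtain ⟨c, hc⟩ := he
    obtain ⟨d, hd⟩ := hf
    refine ⟨2 * c + 2 * d + 1, fun S σ h => ?_⟩
    have h1 := hc S σ h
    have h2 := hd S σ h
    have h3 := hop (e.eval σ) (f.eval σ)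
    have h4 : (2 * c + 2 * d + 1) * (S + 1)
      = 2 * (c * (S + 1)) + 2 * (d * (S + 1)) + (S + 1) := by ring
    rw [h4]
    omega
  induction e with
  | const n =>
    refine ⟨1 + Nat.size n, fun S σ _ => ?_⟩
    simp only [NatExpr.eval, NatExpr.cost]
    constructor <;> nlinarith
  | load a k ih =>
    obtain ⟨c, hc⟩ := ih
    refine ⟨2 * c + 1, fun S σ h => ?_⟩
    have h1 := hc S σ h
    have h2 := h a (k.eval σ)
    have h4 : (2 * c + 1) * (S + 1) = 2 * (c * (S + 1)) + (S + 1) := by ring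
    rw [h4]
    simp only [NatExpr.eval, NatExpr.cost]
    omega
  | add e f he hf => exact binary he hf (· + ·) size_add_le
  | sub e f he hf =>
    exact binary he hf (· - ·) fun m n => by
      have : Nat.size (m - n) ≤ Nat.size m := Nat.size_le_size (Nat.sub_le m n)
      omega
  | mul e f he hf =>
    exact binary he hf (· * ·) fun m n => (size_mul_le m n).trans (Nat.le_succ _)
  | div e f he hf =>
    exact binary he hf (· / ·) fun m n => by
      have : Nat.size (m / n) ≤ Nat.size m := Nat.size_le_size (Nat.div_le_self m n)
      omega

theorem RealExpr.exists_bound (e : RealExpr) : ∃ c, ∀ (S : ℕ) (σ : State), σ.Bdd S →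
    e.cost σ ≤ c * (S + 1) := by
  have binary {e f : RealExpr} (he : ∃ c, ∀ (S : ℕ) (σ : State), σ.Bdd S → e.cost σ ≤ c * (S + 1))
      (hf : ∃ c, ∀ (S : ℕ) (σ : State), σ.Bdd S → f.cost σ ≤ c * (S + 1)) :
      ∃ c, ∀ (S : ℕ) (σ : State), σ.Bdd S → e.cost σ + f.cost σ + 1 ≤ c * (S + 1) := by
    obtain ⟨c, hc⟩ := he
    obtain ⟨d, hd⟩ := hf
    refine ⟨c + d + 1, fun S σ h => ?_⟩
    have h1 := hc S σ h
    have h2 := hd S σ h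
    rw [add_mul, add_mul]
    omega
  induction e with
  | ofNat e =>
    obtain ⟨c, hc⟩ := e.exists_bound
    refine ⟨2 * c + 1, fun S σ h => ?_⟩
    have h1 := hc S σ h
    rw [add_mul, mul_assoc]
    simp only [RealExpr.cost]
    omega
  | load a k =>
    obtain ⟨c, hc⟩ := k.exists_bound
    refine ⟨2 * c + 1, fun S σ h => ?_⟩
    have h1 := hc S σ h
    rw [add_mul, mul_assoc]
    simp only [RealExpr.cost]
    omega
  | add e f he hf => exact binary he hf
  | sub e f he hf => exact binary he hf
  | mul e f he hf => exact binary he hf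
  | div e f he hf => exact binary he hf
  | exp e he =>
    obtain ⟨c, hc⟩ := he
    refine ⟨c + 1, fun S σ h => ?_⟩
    have h1 := hc S σ h
    rw [add_mul]
    simp only [RealExpr.cost]
    omega

theorem Test.exists_bound (e : Test) : ∃ c, ∀ (S : ℕ) (σ : State), σ.Bdd S →
    e.cost σ ≤ c * (S + 1) := by
  induction e with
  | natLe e f =>
    obtain ⟨c, hc⟩ := e.exists_bound
    obtain ⟨d, hd⟩ := f.exists_bound
    refine ⟨2 * c + 2 * d + 1, fun S σ h => ?_⟩
    have h1 := hc S σ h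
    have h2 := hd S σ h
    simp only [add_mul, mul_assoc, Test.cost]
    omega
  | realLe e f =>
    obtain ⟨c, hc⟩ := e.exists_bound
    obtain ⟨d, hd⟩ := f.exists_bound
    refine ⟨c + d + 1, fun S σ h => ?_⟩
    have h1 := hc S σ h
    have h2 := hd S σ h
    simp only [add_mul, Test.cost]
    omega
  | not e he =>
    obtain ⟨c, hc⟩ := he
    refine ⟨c + 1, fun S σ h => ?_⟩
    have h1 := hc S σ h
    simp only [add_mul, Test.cost]
    omega
  | and e f he hf =>
    obtain ⟨c, hc⟩ := he
    obtain ⟨d, hd⟩ := hf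
    refine ⟨c + d + 1, fun S σ h => ?_⟩
    have h1 := hc S σ h
    have h2 := hd S σ h
    simp only [add_mul, Test.cost]
    omega

theorem State.Bdd.mono {σ : State} {S S' : ℕ} (h : σ.Bdd S) (hS : S ≤ S') : σ.Bdd S' :=
  fun a k => (h a k).trans hS

theorem State.Bdd.setNat {σ : State} {S : ℕ} (h : σ.Bdd S) (a k : ℕ) {v : ℕ}
    (hv : Nat.size v ≤ S) : (σ.setNat a k v).Bdd S := by
  intro a' k'
  simp only [State.setNat, Function.update_apply]
  split_ifs with h1
  · simp only [Function.update_apply]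
    split_ifs
    · exact hv
    · exact h a k'
  · exact h a' k'

theorem State.Bdd.setReal {σ : State} {S : ℕ} (h : σ.Bdd S) (a k : ℕ) (v : ℝ) :
    (σ.setReal a k v).Bdd S := h

/-- Programs without loops. -/
def Program.LoopFree : Program → Prop
  | .seq p q => p.LoopFree ∧ q.LoopFree
  | .cond _ p q => p.LoopFree ∧ q.LoopFree
  | .loop _ _ => False
  | _ => True

open Classical in
/-- The final memory of a program without loops. -/
noncomputable def Program.exec : Program → State → State
  | .skip, σ => σ
  | .setNat a k e, σ => σ.setNat a (k.eval σ) (e.eval σ)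
  | .setReal a k e, σ => σ.setReal a (k.eval σ) (e.eval σ)
  | .seq p q, σ => q.exec (p.exec σ)
  | .cond c p q, σ => if c.Holds σ then p.exec σ else q.exec σ
  | .loop _ _, σ => σ

theorem Program.exec_skip (σ : State) : Program.skip.exec σ = σ := rfl

theorem Program.exec_setNat (a : ℕ) (k e : NatExpr) (σ : State) :
    (Program.setNat a k e).exec σ = σ.setNat a (k.eval σ) (e.eval σ) := rfl

theorem Program.exec_setReal (a : ℕ) (k : NatExpr) (e : RealExpr) (σ : State) :
    (Program.setReal a k e).exec σ = σ.setReal a (k.eval σ) (e.eval σ) := rfl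

theorem Program.exec_seq (p q : Program) (σ : State) :
    (Program.seq p q).exec σ = q.exec (p.exec σ) := rfl

theorem Program.exec_cond_of_holds {c : Test} {p q : Program} {σ : State} (h : c.Holds σ) :
    (Program.cond c p q).exec σ = p.exec σ := by
  simp only [Program.exec, if_pos h]

theorem Program.exec_cond_of_not_holds {c : Test} {p q : Program} {σ : State}
    (h : ¬ c.Holds σ) : (Program.cond c p q).exec σ = q.exec σ := by
  simp only [Program.exec, if_neg h]

/-- Each instruction may stretch the integers by a constant factor; without loops these factors
multiply to a constant that depends only on the program. -/
theorem Program.LoopFree.exists_bound {p : Program} (hp : p.LoopFree) :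
    ∃ c, ∀ (S : ℕ) (σ : State), σ.Bdd S →
      (∃ t, Runs p σ (p.exec σ) t ∧ t ≤ c * (S + 1)) ∧ (p.exec σ).Bdd (c * (S + 1)) := by
  induction p with
  | skip => exact ⟨1, fun S σ h => ⟨⟨1, .skip σ, by omega⟩, h.mono (by omega)⟩⟩
  | setNat a k e =>
    obtain ⟨c, hc⟩ := k.exists_bound
    obtain ⟨d, hd⟩ := e.exists_bound
    refine ⟨2 * c + 2 * d + 1, fun S σ h => ?_⟩
    have h1 := hc S σ h
    have h2 := hd S σ h
    simp only [add_mul, mul_assoc]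
    exact ⟨⟨_, .setNat a k e σ, by omega⟩,
      State.Bdd.setNat (h.mono (by omega)) _ _ (by omega)⟩
  | setReal a k e =>
    obtain ⟨c, hc⟩ := k.exists_bound
    obtain ⟨d, hd⟩ := e.exists_bound
    refine ⟨2 * c + d + 1, fun S σ h => ?_⟩
    have h1 := hc S σ h
    have h2 := hd S σ h
    simp only [add_mul, mul_assoc]
    exact ⟨⟨_, .setReal a k e σ, by omega⟩, State.Bdd.setReal (h.mono (by omega)) _ _ _⟩
  | seq p q ihp ihq =>
    obtain ⟨c, hc⟩ := ihp hp.1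
    obtain ⟨d, hd⟩ := ihq hp.2
    -- The second program starts with integers of length up to `c * (S + 1)`, not `S`.
    refine ⟨c + d * (c + 1), fun S σ h => ?_⟩
    obtain ⟨⟨t, ht, htc⟩, h1⟩ := hc S σ h
    obtain ⟨⟨u, hu, hud⟩, h2⟩ := hd _ _ h1
    have h3 : d * (c * (S + 1) + 1) ≤ d * (c + 1) * (S + 1) := by
      rw [mul_assoc]
      exact Nat.mul_le_mul_left _ (by nlinarith)
    rw [add_mul]
    exact ⟨⟨_, .seq ht hu, by omega⟩, h2.mono (by omega)⟩
  | cond b p q ihp ihq =>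
    obtain ⟨c, hc⟩ := ihp hp.1
    obtain ⟨d, hd⟩ := ihq hp.2
    obtain ⟨e, he⟩ := b.exists_bound
    refine ⟨c + d + e + 1, fun S σ h => ?_⟩
    have h3 := he S σ h
    simp only [add_mul, Program.exec]
    split_ifs with hb
    · obtain ⟨⟨t, ht, htc⟩, h1⟩ := hc S σ h
      exact ⟨⟨_, .condTrue hb ht, by omega⟩, h1.mono (by omega)⟩
    · obtain ⟨⟨t, ht, htc⟩, h1⟩ := hd S σ h
      exact ⟨⟨_, .condFalse hb ht, by omega⟩, h1.mono (by omega)⟩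
  | loop c p ih => exact hp.elim

/-- Started in a memory `σ` with `Pre S σ` and integers of length at most `S`, the program halts
within time polynomial in `S`, in a memory `τ` with `Post S σ τ` and integers of length at most
`S`. -/
def Spec (p : Program) (Pre : ℕ → State → Prop) (Post : ℕ → State → State → Prop) : Prop :=
  ∃ f : Polynomial ℕ, ∀ (S : ℕ) (σ : State), σ.Bdd S → Pre S σ →
    ∃ (τ : State) (t : ℕ), Runs p σ τ t ∧ t ≤ f.eval S ∧ τ.Bdd S ∧ Post S σ τ

theorem Spec.consequence {p : Program} {Pre Pre' : ℕ → State → Prop}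
    {Post Post' : ℕ → State → State → Prop} (h : Spec p Pre Post)
    (hpre : ∀ S σ, σ.Bdd S → Pre' S σ → Pre S σ)
    (hpost : ∀ S σ τ, σ.Bdd S → τ.Bdd S → Pre' S σ → Post S σ τ → Post' S σ τ) :
    Spec p Pre' Post' := by
  obtain ⟨f, hf⟩ := h
  refine ⟨f, fun S σ hσ hP => ?_⟩
  obtain ⟨τ, t, h1, h2, h3, h4⟩ := hf S σ hσ (hpre S σ hσ hP)
  exact ⟨τ, t, h1, h2, h3, hpost S σ τ hσ h3 hP h4⟩

/-- The time is linear in `S` automatically, but a constant factor in the lengths would compound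
when the program is the body of a loop. The hypothesis `h` therefore asks that the lengths stay
below the same `S`. -/
theorem Spec.ofLoopFree {p : Program} {Pre : ℕ → State → Prop} (hp : p.LoopFree)
    (h : ∀ S σ, σ.Bdd S → Pre S σ → (p.exec σ).Bdd S) :
    Spec p Pre (fun _ σ τ => τ = p.exec σ) := by
  obtain ⟨c, hc⟩ := hp.exists_bound
  refine ⟨.C c * (.X + .C 1), fun S σ hσ hP => ?_⟩
  obtain ⟨⟨t, h1, h2⟩, -⟩ := hc S σ hσ
  exact ⟨_, t, h1, by simpa using h2, h S σ hσ hP, rfl⟩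

/-- Because `S` still bounds the intermediate memory, the two time polynomials are added and not
composed. -/
theorem Spec.seq {p q : Program} {Pre Pre' : ℕ → State → Prop}
    {Mid Post' : ℕ → State → State → Prop} (hp : Spec p Pre Mid) (hq : Spec q Pre' Post')
    (h : ∀ S σ τ, σ.Bdd S → τ.Bdd S → Pre S σ → Mid S σ τ → Pre' S τ) :
    Spec (.seq p q) Pre (fun S σ υ => ∃ τ, τ.Bdd S ∧ Mid S σ τ ∧ Post' S τ υ) := by
  obtain ⟨f, hf⟩ := hp
  obtain ⟨g, hg⟩ := hq
  refine ⟨f + g, fun S σ hσ hP => ?_⟩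
  obtain ⟨τ, t, h1, h2, h3, h4⟩ := hf S σ hσ hP
  obtain ⟨υ, u, h5, h6, h7, h8⟩ := hg S τ h3 (h S σ τ hσ h3 hP h4)
  refine ⟨υ, t + u, .seq h1 h5, ?_, h7, τ, h3, h4, h8⟩
  rw [Polynomial.eval_add]
  omega

/-- The loop rule, with an invariant that relates the memory to the memory at the start of the
loop, and a variant. -/
theorem Spec.loop {c : Test} {p : Program} {Pre BPre : ℕ → State → Prop}
    {BPost Inv : ℕ → State → State → Prop} (hp : Spec p BPre BPost)
    (μ : ℕ → State → State → ℕ)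
    (hinit : ∀ S σ, σ.Bdd S → Pre S σ → Inv S σ σ)
    (hμ : ∀ S σ₀ σ, σ.Bdd S → Pre S σ₀ → Inv S σ₀ σ → μ S σ₀ σ ≤ S)
    (hpre : ∀ S σ₀ σ, σ.Bdd S → Pre S σ₀ → Inv S σ₀ σ → c.Holds σ → BPre S σ)
    (hstep : ∀ S σ₀ σ τ, σ.Bdd S → τ.Bdd S → Pre S σ₀ → Inv S σ₀ σ → c.Holds σ →
      BPost S σ τ → Inv S σ₀ τ ∧ μ S σ₀ τ < μ S σ₀ σ) :
    Spec (.loop c p) Pre (fun S σ τ => Inv S σ τ ∧ ¬ c.Holds τ) := by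
  obtain ⟨f, hf⟩ := hp
  obtain ⟨d, hd⟩ := c.exists_bound
  refine ⟨(.X + .C 1) * (.C d * (.X + .C 1) + f + .C 1), fun S σ₀ hσ₀ hP => ?_⟩
  have key (m : ℕ) : ∀ σ, σ.Bdd S → Inv S σ₀ σ → μ S σ₀ σ ≤ m →
      ∃ (τ : State) (t : ℕ), Runs (.loop c p) σ τ t ∧
        t ≤ (m + 1) * (d * (S + 1) + f.eval S + 1) ∧ τ.Bdd S ∧
        (Inv S σ₀ τ ∧ ¬ c.Holds τ) := by
    induction m with
    | zero =>
      intro σ hσ hI hm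
      -- At variant zero the test has to fail, since a run of the body would decrease the variant
      -- further.
      have hc : ¬ c.Holds σ := fun hc => by
        obtain ⟨τ, t, h1, h2, h3, h4⟩ := hf S σ hσ (hpre S σ₀ σ hσ hP hI hc)
        have := (hstep S σ₀ σ τ hσ h3 hP hI hc h4).2
        omega
      have := hd S σ hσ
      exact ⟨σ, _, .loopFalse hc, by omega, hσ, hI, hc⟩
    | succ m ih =>
      intro σ hσ hI hm
      have hcost := hd S σ hσ
      by_cases hc : c.Holds σ
      · obtain ⟨τ, t, h1, h2, h3, h4⟩ := hf S σ hσ (hpre S σ₀ σ hσ hP hI hc)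
        have h5 := hstep S σ₀ σ τ hσ h3 hP hI hc h4
        obtain ⟨υ, u, h6, h7, h8⟩ := ih τ h3 h5.1 (by omega)
        refine ⟨υ, _, .loopTrue hc h1 h6, ?_, h8⟩
        rw [add_mul (m + 1)]
        omega
      · refine ⟨σ, _, .loopFalse hc, ?_, hσ, hI, hc⟩
        rw [add_mul]
        omega
  obtain ⟨τ, t, h1, h2, h3⟩ := key S σ₀ hσ₀ (hinit S σ₀ hσ₀ hP)
    (hμ S σ₀ σ₀ hσ₀ hP (hinit S σ₀ hσ₀ hP))
  exact ⟨τ, t, h1, by simpa using h2, h3⟩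

/-! ## Search and iteration -/

/-- The memories agree, except possibly in the integer arrays `A` and the real arrays `B`. -/
structure SameOff (A B : Set ℕ) (σ τ : State) : Prop where
  nats : ∀ a ∉ A, τ.nats a = σ.nats a
  reals : ∀ a ∉ B, τ.reals a = σ.reals a

theorem SameOff.refl (A B : Set ℕ) (σ : State) : SameOff A B σ σ :=
  ⟨fun _ _ => rfl, fun _ _ => rfl⟩

theorem SameOff.trans {A B A' B' A'' B'' : Set ℕ} {σ τ υ : State} (h : SameOff A B σ τ)
    (h' : SameOff A' B' τ υ) (hA : A ⊆ A'' := by simp [Set.insert_subset_iff])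
    (hB : B ⊆ B'' := by simp [Set.insert_subset_iff])
    (hA' : A' ⊆ A'' := by simp [Set.insert_subset_iff])
    (hB' : B' ⊆ B'' := by simp [Set.insert_subset_iff]) : SameOff A'' B'' σ υ :=
  ⟨fun a ha => (h'.nats a (fun h => ha (hA' h))).trans (h.nats a (fun h => ha (hA h))),
    fun a ha => (h'.reals a (fun h => ha (hB' h))).trans (h.reals a (fun h => ha (hB h)))⟩

theorem SameOff.setNat {A B : Set ℕ} {σ τ : State} (h : SameOff A B σ τ) (a k v : ℕ)
    (ha : a ∈ A := by simp) : SameOff A B σ (τ.setNat a k v) :=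
  ⟨fun a' ha' => by
    rw [← h.nats a' ha']
    exact Function.update_of_ne (by rintro rfl; exact ha' ha) _ _, h.reals⟩

theorem SameOff.setReal {A B : Set ℕ} {σ τ : State} (h : SameOff A B σ τ) (a k : ℕ) (v : ℝ)
    (ha : a ∈ B := by simp) : SameOff A B σ (τ.setReal a k v) :=
  ⟨h.nats, fun a' ha' => by
    rw [← h.reals a' ha']
    exact Function.update_of_ne (by rintro rfl; exact ha' ha) _ _⟩

@[simp] theorem State.nats_setNat (σ : State) (a k v a' : ℕ) :
    (σ.setNat a k v).nats a' =
      if a' = a then Function.update (σ.nats a) k v else σ.nats a' := by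
  simp [State.setNat, Function.update_apply]

@[simp] theorem State.reals_setNat (σ : State) (a k v : ℕ) :
    (σ.setNat a k v).reals = σ.reals := rfl

@[simp] theorem State.reals_setReal (σ : State) (a k : ℕ) (v : ℝ) (a' : ℕ) :
    (σ.setReal a k v).reals a' =
      if a' = a then Function.update (σ.reals a) k v else σ.reals a' := by
  simp [State.setReal, Function.update_apply]

@[simp] theorem State.nats_setReal (σ : State) (a k : ℕ) (v : ℝ) :
    (σ.setReal a k v).nats = σ.nats := rfl

/-- An integer array used as a variable. -/
abbrev NatExpr.var (a : ℕ) : NatExpr := .load a (.const 0)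

/-- Assignment to an integer variable. -/
abbrev Program.assign (a : ℕ) (e : NatExpr) : Program := .setNat a (.const 0) e

/-- `k ≤ R` is a place where the predicate `T` on `{0, …, R - 1}` switches from false to true. -/
structure IsCutoff (R : ℕ) (T : ℕ → Prop) (k : ℕ) : Prop where
  le : k ≤ R
  pred : 0 < k → ¬ T (k - 1)
  self : k < R → T k

/-- Binary search for a cutoff of the test `c` on the variable `7`; the result is in variable `5`
and the range of the search is given by the entry `1` of array `0`. -/
def binarySearch (c : Test) : Program :=
  .seq (.seq (.assign 5 (.const 0)) (.assign 6 (.load 0 (.const 1))))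
    (.loop (.not (.natLe (.var 6) (.var 5)))
      (.seq (.assign 7 (.div (.add (.var 5) (.var 6)) (.const 2)))
        (.cond c (.assign 6 (.var 7)) (.assign 5 (.add (.var 7) (.const 1))))))

/-- Halving removes a binary digit; this is the source of the logarithmic number of rounds in the
binary search. -/
theorem size_lt_size_of_le_half {m n : ℕ} (hn : 0 < n) (h : m ≤ n / 2) :
    Nat.size m < Nat.size n := by
  have h1 := Nat.lt_size_self n
  have h2 : 0 < Nat.size n := Nat.size_pos.2 hn
  obtain ⟨s, hs⟩ : ∃ s, Nat.size n = s + 1 := ⟨_, (Nat.succ_pred_eq_of_pos h2).symm⟩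
  rw [hs, Nat.lt_succ_iff, Nat.size_le]
  rw [hs, pow_succ] at h1
  omega

/-- The invariant is that `T` fails just below the lower end and holds at the upper end, unless the
ends are `0` and `R`. Monotonicity of `T` is not needed for a switch to exist. `T` is quantified
inside the postcondition so that it may depend on the memory in which the search starts. -/
theorem spec_binarySearch (c : Test) :
    Spec (binarySearch c) (fun _ _ => True) (fun _ σ τ => SameOff {5, 6, 7} ∅ σ τ ∧
      ∀ T : ℕ → Prop, (∀ σ', SameOff {5, 6, 7} ∅ σ σ' → (c.Holds σ' ↔ T (σ'.nats 7 0))) →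
        IsCutoff (σ.nats 0 1) T (τ.nats 5 0)) := by
  have hbody := Spec.ofLoopFree
      (p := .seq (.assign 7 (.div (.add (.var 5) (.var 6)) (.const 2)))
        (.cond c (.assign 6 (.var 7)) (.assign 5 (.add (.var 7) (.const 1)))))
      (Pre := fun _ σ => σ.nats 5 0 < σ.nats 6 0) ⟨trivial, trivial, trivial⟩ (by
    intro S σ hσ h
    have hS := hσ 6 0
    rw [Program.exec_seq]
    have h7 : ((Program.assign 7 (.div (.add (.var 5) (.var 6)) (.const 2))).exec σ).Bdd S := by
      refine hσ.setNat _ _ ?_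
      simp only [NatExpr.eval]
      exact (Nat.size_le_size (by omega)).trans hS
    by_cases hc : c.Holds ((Program.assign 7 (.div (.add (.var 5) (.var 6)) (.const 2))).exec σ)
    · rw [Program.exec_cond_of_holds hc]
      exact h7.setNat _ _ (h7 _ _)
    · rw [Program.exec_cond_of_not_holds hc]
      refine h7.setNat _ _ ?_
      simp [NatExpr.eval, Program.exec_setNat]
      exact (Nat.size_le_size (by omega)).trans hS)
  have hloop := Spec.loop (c := .not (.natLe (.var 6) (.var 5)))
    (Pre := fun _ σ => σ.nats 5 0 = 0 ∧ σ.nats 6 0 = σ.nats 0 1) hbody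
    (Inv := fun _ σ τ => SameOff {5, 6, 7} ∅ σ τ ∧
      τ.nats 5 0 ≤ τ.nats 6 0 ∧ τ.nats 6 0 ≤ σ.nats 0 1 ∧
      ∀ T : ℕ → Prop, (∀ σ', SameOff {5, 6, 7} ∅ σ σ' → (c.Holds σ' ↔ T (σ'.nats 7 0))) →
        (0 < τ.nats 5 0 → ¬ T (τ.nats 5 0 - 1)) ∧ (τ.nats 6 0 < σ.nats 0 1 → T (τ.nats 6 0)))
    -- The gap itself may be exponential in `S`, so the variant is its binary length.
    (fun _ _ σ => Nat.size (σ.nats 6 0 - σ.nats 5 0))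
    (fun S σ hσ h => ⟨.refl _ _ _, by omega, by omega, fun T hT => ⟨by omega, by omega⟩⟩)
    (fun S σ₀ σ hσ h hI => (Nat.size_le_size (Nat.sub_le _ _)).trans (hσ 6 0))
    (fun S σ₀ σ hσ h hI hc => by simpa [Test.Holds, NatExpr.eval] using hc) (by
      rintro S σ₀ σ τ hσ hτ ⟨h1, h2⟩ ⟨hs, h3, h4, hT⟩ hc rfl
      have hlt : σ.nats 5 0 < σ.nats 6 0 := by simpa [Test.Holds, NatExpr.eval] using hc
      set mid := (σ.nats 5 0 + σ.nats 6 0) / 2 with hmid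
      have hs' : SameOff {5, 6, 7} ∅ σ₀ (σ.setNat 7 0 mid) := hs.setNat _ _ _
      rw [Program.exec_seq,
        show (Program.assign 7 (.div (.add (.var 5) (.var 6)) (.const 2))).exec σ
        = σ.setNat 7 0 mid from rfl]
      by_cases hc' : c.Holds (σ.setNat 7 0 mid)
      · rw [Program.exec_cond_of_holds hc']
        refine ⟨⟨hs'.setNat _ _ _, ?_, ?_, fun T hT' => ?_⟩, ?_⟩
        · simp [Program.exec_setNat, NatExpr.eval]; omega
        · simp [Program.exec_setNat, NatExpr.eval]; omega
        · have h5 := (hT' _ hs').1 hc'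
          have h6 := hT T hT'
          simp [Program.exec_setNat, NatExpr.eval] at h5 ⊢
          exact ⟨h6.1, fun _ => h5⟩
        · simp [Program.exec_setNat, NatExpr.eval]
          exact size_lt_size_of_le_half (by omega) (by omega)
      · rw [Program.exec_cond_of_not_holds hc']
        refine ⟨⟨hs'.setNat _ _ _, ?_, ?_, fun T hT' => ?_⟩, ?_⟩
        · simp [Program.exec_setNat, NatExpr.eval]; omega
        · simp [Program.exec_setNat, NatExpr.eval]; omega
        · have h5 := mt (hT' _ hs').2 hc'
          have h6 := hT T hT'
          simp [Program.exec_setNat, NatExpr.eval] at h5 ⊢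
          exact ⟨h5, h6.2⟩
        · simp [Program.exec_setNat, NatExpr.eval]
          exact size_lt_size_of_le_half (by omega) (by omega))
  have hinit := Spec.ofLoopFree
    (p := .seq (.assign 5 (.const 0)) (.assign 6 (.load 0 (.const 1))))
    (Pre := fun _ _ => True) ⟨trivial, trivial⟩ (by
      intro S σ hσ _
      refine (hσ.setNat _ _ (by simp [NatExpr.eval])).setNat _ _ ?_
      simpa [NatExpr.eval, Program.exec] using hσ 0 1)
  refine (hinit.seq hloop ?_).consequence (fun _ _ _ h => h) ?_
  · rintro S σ τ hσ hτ - rfl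
    simp [Program.exec, NatExpr.eval]
  · rintro S σ υ hσ hυ - ⟨τ, -, rfl, ⟨hs, h1, h2, hT⟩, hc⟩
    have hs₀ : SameOff {5, 6, 7} ∅ σ
      (Program.exec (.seq (.assign 5 (.const 0)) (.assign 6 (.load 0 (.const 1)))) σ) :=
      ((SameOff.refl _ _ σ).setNat _ _ _).setNat _ _ _
    refine ⟨hs₀.trans hs, fun T hT' => ?_⟩
    have h3 := hT T fun σ' h => hT' σ' (hs₀.trans h)
    have h4 : υ.nats 6 0 = υ.nats 5 0 := by
      have : υ.nats 6 0 ≤ υ.nats 5 0 := by simpa [Test.Holds, NatExpr.eval] using hc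
      omega
    rw [hs₀.nats 0 (by simp)] at h2 h3
    exact ⟨by omega, h3.1, by rw [← h4]; exact h3.2⟩

/-- For each value of variable `3` from its current value up to `count`, search for a cutoff of
`c`, then run `f`. -/
def forEach (count : NatExpr) (c : Test) (f : Program) : Program :=
  .loop (.not (.natLe count (.var 3)))
    (.seq (binarySearch c) (.seq f (.assign 3 (.add (.var 3) (.const 1)))))

/-- `J σ₀ m` is the invariant after `m` rounds. It must survive changes of the loop counter and of
the search variables (`hstable`), so that the search can run between two applications of `hstep`. -/
theorem spec_forEach {count : NatExpr} {c : Test} {f : Program} (hf : f.LoopFree)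
    {Pre : ℕ → State → Prop} (J : State → ℕ → State → Prop) (T : State → ℕ → ℕ → Prop)
    (cnt : State → ℕ) (hS : ∀ S σ₀, Pre S σ₀ → cnt σ₀ ≤ S)
    (hcount : ∀ S σ₀ m σ, Pre S σ₀ → J σ₀ m σ → count.eval σ = cnt σ₀)
    (hR : ∀ S σ₀ m σ, Pre S σ₀ → J σ₀ m σ → σ.nats 0 = σ₀.nats 0)
    (hstable : ∀ σ₀ m σ τ, J σ₀ m σ → SameOff {3, 5, 6, 7} ∅ σ τ → J σ₀ m τ)
    (h0 : ∀ S σ₀, Pre S σ₀ → σ₀.nats 3 0 = 0 ∧ J σ₀ 0 σ₀)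
    (hc : ∀ S σ₀ m σ, Pre S σ₀ → J σ₀ m σ → m < cnt σ₀ → σ.nats 3 0 = m →
      (c.Holds σ ↔ T σ₀ m (σ.nats 7 0)))
    (hstep : ∀ S σ₀ m σ, Pre S σ₀ → J σ₀ m σ → m < cnt σ₀ → σ.nats 3 0 = m → σ.Bdd S →
      IsCutoff (σ₀.nats 0 1) (T σ₀ m) (σ.nats 5 0) →
      (f.exec σ).Bdd S ∧ J σ₀ (m + 1) (f.exec σ) ∧ (f.exec σ).nats 3 0 = m) :
    Spec (forEach count c f) Pre (fun _ σ τ => J σ (cnt σ) τ) := by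
  have htail := Spec.ofLoopFree (p := .seq f (.assign 3 (.add (.var 3) (.const 1))))
    (Pre := fun S σ => (f.exec σ).Bdd S ∧ (f.exec σ).nats 3 0 < S) ⟨hf, trivial⟩
    fun S σ hσ h => h.1.setNat _ _
      ((size_le_self _).trans (by simpa [NatExpr.eval] using Nat.succ_le_of_lt h.2))
  have hbody := ((spec_binarySearch c).consequence
    -- The specification of the body sees only the current memory, hence the initial memory is
    -- hidden in an existential. The loop rule below supplies the actual one, and the result of the
    -- search is interpreted again for it.
    (Pre' := fun S σ => ∃ σ₀, Pre S σ₀ ∧ J σ₀ (σ.nats 3 0) σ ∧ σ.nats 3 0 < cnt σ₀)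
    (fun _ _ _ _ => trivial) (fun _ _ _ _ _ _ h => h)).seq htail (by
      rintro S σ τ hσ hτ ⟨σ₀, hP, hJ, hlt⟩ ⟨hs, hT⟩
      have h3 : τ.nats 3 = σ.nats 3 := hs.nats 3 (by simp)
      have hstab (σ') (h : SameOff {5, 6, 7} ∅ σ σ') : J σ₀ (σ.nats 3 0) σ' :=
        hstable _ _ _ _ hJ (h.trans (.refl ∅ ∅ _))
      have h4 := hstep S σ₀ (σ.nats 3 0) τ hP (hstab τ hs) hlt (by rw [h3]) hτ (by
        rw [← hR S σ₀ _ σ hP hJ]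
        exact hT _ fun σ' h => hc S σ₀ _ σ' hP (hstab σ' h) hlt (by rw [h.nats 3 (by simp)]))
      exact ⟨h4.1, h4.2.2.trans_lt (hlt.trans_le (hS S σ₀ hP))⟩)
  have hloop := Spec.loop (c := .not (.natLe count (.var 3))) (Pre := Pre) hbody
    (Inv := fun _ σ₀ σ => J σ₀ (σ.nats 3 0) σ ∧ σ.nats 3 0 ≤ cnt σ₀)
    (fun _ σ₀ σ => cnt σ₀ - σ.nats 3 0)
    (fun S σ hσ h => by rw [(h0 S σ h).1]; exact ⟨(h0 S σ h).2, by omega⟩)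
    (fun S σ₀ σ hσ h hI => (Nat.sub_le _ _).trans (hS S σ₀ h))
    (fun S σ₀ σ hσ h hI hc' => ⟨σ₀, h, hI.1, by
      simpa [Test.Holds, NatExpr.eval, hcount S σ₀ _ σ h hI.1] using hc'⟩) (by
      rintro S σ₀ σ υ hσ hυ hP ⟨hJ, -⟩ hlt ⟨τ, hτ, ⟨hs, hT⟩, rfl⟩
      replace hlt : σ.nats 3 0 < cnt σ₀ := by
        simpa [Test.Holds, NatExpr.eval, hcount S σ₀ _ σ hP hJ] using hlt
      have h3 : τ.nats 3 = σ.nats 3 := hs.nats 3 (by simp)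
      have hstab (σ') (h : SameOff {5, 6, 7} ∅ σ σ') : J σ₀ (σ.nats 3 0) σ' :=
        hstable _ _ _ _ hJ (h.trans (.refl ∅ ∅ _))
      obtain ⟨-, h5, h6⟩ := hstep S σ₀ (σ.nats 3 0) τ hP (hstab τ hs) hlt (by rw [h3]) hτ (by
        rw [← hR S σ₀ _ σ hP hJ]
        exact hT _ fun σ' h => hc S σ₀ _ σ' hP (hstab σ' h) hlt (by rw [h.nats 3 (by simp)]))
      have h7 : ((Program.seq f (.assign 3 (.add (.var 3) (.const 1)))).exec τ).nats 3 0
          = σ.nats 3 0 + 1 := by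
        simp [Program.exec, NatExpr.eval, h6]
      rw [h7]
      exact ⟨⟨hstable _ _ _ _ h5 ((SameOff.refl _ _ _).setNat _ _ _), hlt⟩, by omega⟩)
  refine hloop.consequence (fun _ _ _ h => h) fun S σ τ hσ hτ hP ⟨⟨hJ, hle⟩, hc'⟩ => ?_
  have : cnt σ ≤ τ.nats 3 0 := by
    simpa [Test.Holds, NatExpr.eval, hcount S σ _ τ hP hJ] using hc'
  rwa [le_antisymm hle this] at hJ

/-- Counting with a real comparison is the substitute for rounding a real number up. The witness `M
σ₀ ≤ S` guarantees that the count stops in time. -/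
theorem spec_countUp {v : ℕ} {c : Test} {Pre : ℕ → State → Prop} (T : State → ℕ → Prop)
    (M : State → ℕ) (h0 : ∀ S σ₀, Pre S σ₀ → σ₀.nats v 0 = 0)
    (hM : ∀ S σ₀, Pre S σ₀ → T σ₀ (M σ₀) ∧ M σ₀ ≤ S)
    (hc : ∀ S σ₀ σ, Pre S σ₀ → SameOff {v} ∅ σ₀ σ → (c.Holds σ ↔ ¬ T σ₀ (σ.nats v 0))) :
    Spec (.loop c (.assign v (.add (.var v) (.const 1)))) Pre (fun _ σ τ =>
      SameOff {v} ∅ σ τ ∧ T σ (τ.nats v 0) ∧ ∀ j < τ.nats v 0, ¬ T σ j) := by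
  have hbody := Spec.ofLoopFree (p := .assign v (.add (.var v) (.const 1)))
    (Pre := fun S σ => σ.nats v 0 < S) trivial fun S σ hσ h =>
      hσ.setNat _ _ ((size_le_self _).trans (by simpa [NatExpr.eval] using Nat.succ_le_of_lt h))
  have hlt {S σ₀ σ} (hP : Pre S σ₀) (hI : SameOff {v} ∅ σ₀ σ ∧ ∀ j < σ.nats v 0, ¬ T σ₀ j)
      (h : c.Holds σ) : σ.nats v 0 < M σ₀ := by
    by_contra hn
    rcases (not_lt.1 hn).eq_or_lt with h' | h'
    · exact (hc S σ₀ σ hP hI.1).1 h (h' ▸ (hM S σ₀ hP).1)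
    · exact hI.2 _ h' (hM S σ₀ hP).1
  have hloop := Spec.loop (c := c) (Pre := Pre) hbody
    (Inv := fun _ σ₀ σ => SameOff {v} ∅ σ₀ σ ∧ ∀ j < σ.nats v 0, ¬ T σ₀ j)
    (fun _ σ₀ σ => M σ₀ - σ.nats v 0)
    (fun S σ hσ h => ⟨.refl _ _ _, by simp [h0 S σ h]⟩)
    (fun S σ₀ σ hσ h hI => (Nat.sub_le _ _).trans (hM S σ₀ h).2)
    (fun S σ₀ σ hσ h hI hcσ => (hlt h hI hcσ).trans_le (hM S σ₀ h).2) (by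
      rintro S σ₀ σ τ hσ hτ hP hI hcσ rfl
      have h1 := hlt hP hI hcσ
      have h2 : ((Program.assign v (.add (.var v) (.const 1))).exec σ).nats v 0
          = σ.nats v 0 + 1 := by simp [Program.exec_setNat, NatExpr.eval]
      rw [h2]
      refine ⟨⟨hI.1.setNat _ _ _, fun j hj => ?_⟩, by omega⟩
      rcases (Nat.lt_succ_iff.1 hj).eq_or_lt with rfl | hj
      · exact (hc S σ₀ σ hP hI.1).1 hcσ
      · exact hI.2 j hj)
  exact hloop.consequence (fun _ _ _ h => h) fun S σ τ hσ hτ hP ⟨hI, hn⟩ =>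
    ⟨hI.1, by simpa [hc S σ τ hP hI.1] using hn, hI.2⟩

/-! ## Min-plus dynamic programming -/

/-- Entry `i` of the table `D`, in row `i / (N + 1)` and column `q = i % (N + 1)`, is the minimum
over `d ≤ q` of the entry in column `q - d` of the preceding row of `D` plus the entry in column
`d` of the preceding row of `W`, and `ch i` is a minimizer. -/
structure MinPlusAt (N : ℕ) (W D : ℕ → ℝ) (ch : ℕ → ℕ) (i : ℕ) : Prop where
  le : ∀ d ≤ i % (N + 1), D i ≤ D (i - (N + 1) - d) + W (i - (N + 1) - i % (N + 1) + d)
  ch_le : ch i ≤ i % (N + 1)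
  eq : D i = D (i - (N + 1) - ch i) + W (i - (N + 1) - i % (N + 1) + ch i)

/-- The width of the tables, whose last column is in variable `2`. -/
abbrev widthExpr : NatExpr := .add (.var 2) (.const 1)

/-- The number of classes. -/
abbrev classesExpr : NatExpr := .mul (.load 0 (.const 0)) (.load 0 (.const 0))

/-- The candidate for the entry of `D` at the index in variable `3`, whose column is in variable
`8`, for the value of `d` in variable `4`. -/
abbrev candidateExpr : RealExpr :=
  .add (.load 5 (.sub (.sub (.var 3) widthExpr) (.var 4)))
    (.load 4 (.add (.sub (.sub (.var 3) widthExpr) (.var 8)) (.var 4)))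

/-- One step of the computation of a minimum. -/
def minPlusStep : Program :=
  .seq
    (.cond (.realLe (.load 5 (.var 3)) candidateExpr) .skip
      (.seq (.setReal 5 (.var 3) candidateExpr) (.setNat 10 (.var 3) (.var 4))))
    (.assign 4 (.add (.var 4) (.const 1)))

/-- The candidate for the entry `i` of the table of the dynamic program. -/
noncomputable def State.candidate (σ : State) (i q d : ℕ) : ℝ :=
  σ.reals 5 (i - (σ.nats 2 0 + 1) - d) + σ.reals 4 (i - (σ.nats 2 0 + 1) - q + d)

/-- A running minimum with its minimizer: the invariant compares the entry with all candidates `d`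
below variable `4`. The loop starts at `1` because the candidate for `d = 0` is already stored. -/
theorem spec_minPlusLoop :
    Spec (.loop (.natLe (.var 4) (.var 8)) minPlusStep)
      (fun S σ => σ.nats 8 0 < S ∧ σ.nats 2 0 + 1 ≤ σ.nats 3 0 ∧ σ.nats 4 0 = 1 ∧
        σ.nats 10 (σ.nats 3 0) = 0 ∧
        σ.reals 5 (σ.nats 3 0) = σ.candidate (σ.nats 3 0) (σ.nats 8 0) 0)
      (fun _ σ τ => SameOff {4, 10} {5} σ τ ∧
        (∀ i, i ≠ σ.nats 3 0 → τ.nats 10 i = σ.nats 10 i) ∧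
        (∀ i, i ≠ σ.nats 3 0 → τ.reals 5 i = σ.reals 5 i) ∧
        (∀ d ≤ σ.nats 8 0, τ.reals 5 (σ.nats 3 0) ≤ σ.candidate (σ.nats 3 0) (σ.nats 8 0) d) ∧
        τ.nats 10 (σ.nats 3 0) ≤ σ.nats 8 0 ∧
        τ.reals 5 (σ.nats 3 0) =
          σ.candidate (σ.nats 3 0) (σ.nats 8 0) (τ.nats 10 (σ.nats 3 0))) := by
  have hbody := Spec.ofLoopFree (p := minPlusStep)
    (Pre := fun S σ => σ.nats 4 0 < S) ⟨⟨trivial, trivial, trivial⟩, trivial⟩ (by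
      intro S σ hσ h
      have h4 : Nat.size (σ.nats 4 0 + 1) ≤ S := (size_le_self _).trans h
      rw [minPlusStep, Program.exec_seq]
      by_cases hc : Test.Holds σ (.realLe (.load 5 (.var 3)) candidateExpr)
      · rw [Program.exec_cond_of_holds hc]
        exact hσ.setNat _ _ h4
      · rw [Program.exec_cond_of_not_holds hc]
        refine State.Bdd.setNat (State.Bdd.setNat (hσ.setReal _ _ _) _ _ (hσ _ _)) _ _ ?_
        simpa [Program.exec, NatExpr.eval] using h4)
  have hloop := Spec.loop (c := .natLe (.var 4) (.var 8))
    (Pre := fun S σ => σ.nats 8 0 < S ∧ σ.nats 2 0 + 1 ≤ σ.nats 3 0 ∧ σ.nats 4 0 = 1 ∧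
        σ.nats 10 (σ.nats 3 0) = 0 ∧
        σ.reals 5 (σ.nats 3 0) = σ.candidate (σ.nats 3 0) (σ.nats 8 0) 0) hbody
    (Inv := fun _ σ τ => SameOff {4, 10} {5} σ τ ∧ τ.nats 4 0 ≤ σ.nats 8 0 + 1 ∧
        (∀ i, i ≠ σ.nats 3 0 → τ.nats 10 i = σ.nats 10 i) ∧
        (∀ i, i ≠ σ.nats 3 0 → τ.reals 5 i = σ.reals 5 i) ∧
        (∀ d < τ.nats 4 0, τ.reals 5 (σ.nats 3 0) ≤ σ.candidate (σ.nats 3 0) (σ.nats 8 0) d) ∧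
        τ.nats 10 (σ.nats 3 0) ≤ σ.nats 8 0 ∧
        τ.reals 5 (σ.nats 3 0) =
          σ.candidate (σ.nats 3 0) (σ.nats 8 0) (τ.nats 10 (σ.nats 3 0)))
    (fun _ σ₀ σ => σ₀.nats 8 0 + 1 - σ.nats 4 0)
    (fun S σ hσ h => ⟨.refl _ _ _, by omega, fun _ _ => rfl, fun _ _ => rfl, fun d hd => by
        obtain rfl : d = 0 := by omega
        exact h.2.2.2.2.le, by omega, by rw [h.2.2.2.1]; exact h.2.2.2.2⟩)
    (fun S σ₀ σ hσ h hI => by omega)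
    (fun S σ₀ σ hσ h hI hc => by
      have h8 := hI.1.nats 8 (by simp)
      have : σ.nats 4 0 ≤ σ.nats 8 0 := by simpa [Test.Holds, NatExpr.eval] using hc
      rw [h8] at this
      omega) (by
      rintro S σ₀ σ τ hσ hτ ⟨h1, h2, h3, -, -⟩ ⟨hs, h5, h6, h7, h8, h9, h10⟩ hc rfl
      have e3 := hs.nats 3 (by simp)
      have e8 := hs.nats 8 (by simp)
      have e2 := hs.nats 2 (by simp)
      have hle : σ.nats 4 0 ≤ σ₀.nats 8 0 := by
        rw [← e8]
        simpa [Test.Holds, NatExpr.eval] using hc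
      have hcand : candidateExpr.eval σ
          = σ₀.candidate (σ₀.nats 3 0) (σ₀.nats 8 0) (σ.nats 4 0) := by
        simp only [RealExpr.eval, NatExpr.eval, e3, e2, e8,
          hs.reals 4 (by simp), State.candidate]
        -- The entry read lies at least one full row before the index being written, so the updates
        -- of the current entry have not changed it.
        rw [h7 _ (by omega)]
      rw [minPlusStep, Program.exec_seq]
      by_cases hc : Test.Holds σ (.realLe (.load 5 (.var 3)) candidateExpr)
      · rw [Program.exec_cond_of_holds hc, Program.exec_skip, Program.exec_setNat]
        have hc' : σ.reals 5 (σ₀.nats 3 0)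
            ≤ σ₀.candidate (σ₀.nats 3 0) (σ₀.nats 8 0) (σ.nats 4 0) := by
          rw [← hcand, ← e3]
          exact hc
        simp only [NatExpr.eval]
        refine ⟨⟨hs.setNat _ _ _, ?_, ?_, ?_, ?_, ?_, ?_⟩, ?_⟩
        · simpa using hle
        · simpa using h6
        · simpa using h7
        · intro d hd
          replace hd : d < σ.nats 4 0 + 1 := by simpa using hd
          rcases (Nat.lt_succ_iff.1 hd).eq_or_lt with rfl | hd
          · exact hc'
          · exact h8 d hd
        · simpa using h9
        · simpa using h10
        · simp
          omega
      · rw [Program.exec_cond_of_not_holds hc, Program.exec_seq, Program.exec_setReal,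
          Program.exec_setNat, Program.exec_setNat, hcand]
        have hc' : σ₀.candidate (σ₀.nats 3 0) (σ₀.nats 8 0) (σ.nats 4 0)
            < σ.reals 5 (σ₀.nats 3 0) := by
          rw [← hcand, ← e3]
          exact not_le.1 hc
        simp only [NatExpr.eval]
        refine ⟨⟨((hs.setReal _ _ _).setNat _ _ _).setNat _ _ _, ?_, ?_, ?_, ?_, ?_, ?_⟩, ?_⟩
        · simpa using hle
        · intro i hi
          simpa [e3, hi] using h6 i hi
        · intro i hi
          simpa [e3, hi] using h7 i hi
        · intro d hd
          replace hd : d < σ.nats 4 0 + 1 := by simpa using hd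
          simp only [State.reals_setNat, State.reals_setReal, e3, if_true, Function.update_self]
          rcases (Nat.lt_succ_iff.1 hd).eq_or_lt with rfl | hd
          · exact le_rfl
          · exact hc'.le.trans (h8 d hd)
        · simpa [e3] using hle
        · simp [e3]
        · simp
          omega)
  refine hloop.consequence (fun _ _ _ h => h) ?_
  rintro S σ τ hσ hτ hP ⟨⟨hs, h5, h6, h7, h8, h9, h10⟩, hc⟩
  have hlt : σ.nats 8 0 < τ.nats 4 0 := by
    rw [← hs.nats 8 (by simp)]
    simpa [Test.Holds, NatExpr.eval] using hc
  exact ⟨hs, h6, h7, fun d hd => h8 d (by omega), h9, h10⟩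

/-- The recurrence at `i` looks only at entries up to `i`, so writing later entries preserves it. -/
theorem MinPlusAt.congr {N : ℕ} {W D D' : ℕ → ℝ} {ch ch' : ℕ → ℕ} {i : ℕ}
    (h : MinPlusAt N W D ch i) (hD : ∀ k ≤ i, D' k = D k) (hch : ch' i = ch i) :
    MinPlusAt N W D' ch' i where
  le d hd := by
    rw [hD i le_rfl, hD _ (by omega)]
    exact h.le d hd
  ch_le := hch ▸ h.ch_le
  eq := by
    rw [hD i le_rfl, hD _ (by omega), hch]
    exact h.eq

/-- Prepare the computation of the entry of `D` at the index in variable `3`. -/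
def minPlusStart : Program :=
  .seq (.assign 8 (.sub (.var 3) (.mul widthExpr (.div (.var 3) widthExpr))))
    (.seq (.setReal 5 (.var 3) (.add (.load 5 (.sub (.var 3) widthExpr))
      (.load 4 (.sub (.sub (.var 3) widthExpr) (.var 8)))))
      (.seq (.setNat 10 (.var 3) (.const 0)) (.assign 4 (.const 1))))

/-- The computation of the table `D` from the index in variable `3` on. -/
def minPlusTable : Program :=
  .loop (.not (.natLe (.mul (.add classesExpr (.const 1)) widthExpr) (.var 3)))
    (.seq minPlusStart (.seq (.loop (.natLe (.var 4) (.var 8)) minPlusStep)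
      (.assign 3 (.add (.var 3) (.const 1)))))

theorem minPlusStart_exec (σ : State) :
    minPlusStart.exec σ = (((σ.setNat 8 0 (σ.nats 3 0 % (σ.nats 2 0 + 1))).setReal 5 (σ.nats 3 0)
      (σ.candidate (σ.nats 3 0) (σ.nats 3 0 % (σ.nats 2 0 + 1)) 0)).setNat 10
        (σ.nats 3 0) 0).setNat 4 0 1 := by
  simp [minPlusStart, Program.exec, NatExpr.eval, RealExpr.eval, State.candidate,
    Nat.mod_eq_sub_mul_div]

theorem spec_minPlusEntry :
    Spec (.seq minPlusStart (.seq (.loop (.natLe (.var 4) (.var 8)) minPlusStep)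
      (.assign 3 (.add (.var 3) (.const 1)))))
      (fun S σ => σ.nats 2 0 + 1 ≤ σ.nats 3 0 ∧ σ.nats 3 0 < S)
      (fun _ σ τ => SameOff {3, 4, 8, 10} {5} σ τ ∧ τ.nats 3 0 = σ.nats 3 0 + 1 ∧
        (∀ i, i ≠ σ.nats 3 0 → τ.nats 10 i = σ.nats 10 i) ∧
        (∀ i, i ≠ σ.nats 3 0 → τ.reals 5 i = σ.reals 5 i) ∧
        MinPlusAt (σ.nats 2 0) (σ.reals 4) (τ.reals 5) (τ.nats 10) (σ.nats 3 0)) := by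
  have hlast := Spec.ofLoopFree (p := .assign 3 (.add (.var 3) (.const 1)))
    (Pre := fun S σ => σ.nats 3 0 < S) trivial fun S σ hσ h =>
      hσ.setNat _ _ ((size_le_self _).trans (by simpa [NatExpr.eval] using Nat.succ_le_of_lt h))
  have hstart := Spec.ofLoopFree (p := minPlusStart)
    (Pre := fun S σ => σ.nats 2 0 + 1 ≤ σ.nats 3 0 ∧ σ.nats 3 0 < S)
    ⟨trivial, trivial, trivial, trivial⟩ (by
      intro S σ hσ h
      rw [minPlusStart_exec]
      refine State.Bdd.setNat (State.Bdd.setNat (State.Bdd.setReal (hσ.setNat _ _ ?_) _ _ _)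
        _ _ (by simp)) _ _ ?_
      · have := Nat.mod_le (σ.nats 3 0) (σ.nats 2 0 + 1)
        exact (size_le_self _).trans (by omega)
      · exact (size_le_self _).trans (by omega))
  have hinner := (spec_minPlusLoop.consequence
    (Pre' := fun S σ => (σ.nats 8 0 < S ∧ σ.nats 2 0 + 1 ≤ σ.nats 3 0 ∧ σ.nats 4 0 = 1 ∧
        σ.nats 10 (σ.nats 3 0) = 0 ∧
        σ.reals 5 (σ.nats 3 0) = σ.candidate (σ.nats 3 0) (σ.nats 8 0) 0) ∧ σ.nats 3 0 < S)
    (fun _ _ _ h => h.1) (fun _ _ _ _ _ _ h => h)).seq hlast (by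
      rintro S σ τ hσ hτ ⟨-, h⟩ ⟨hs, -⟩
      rwa [hs.nats 3 (by simp)])
  refine (hstart.seq hinner ?_).consequence (fun _ _ _ h => h) ?_
  · rintro S σ τ hσ hτ ⟨h1, h2⟩ rfl
    have := Nat.mod_lt (σ.nats 3 0) (Nat.add_one_pos (σ.nats 2 0))
    rw [minPlusStart_exec]
    simp [State.candidate, Function.update_apply]
    refine ⟨⟨by omega, h1, by omega⟩, h2⟩
  · rintro S σ υ hσ hυ ⟨h1, h2⟩ ⟨τ₁, h3, rfl, τ₂, h4, ⟨hs, h6, h7, h8, h9, h10⟩, rfl⟩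
    have hs₁ : SameOff {4, 8, 10} {5} σ (minPlusStart.exec σ) := by
      rw [minPlusStart_exec]
      exact ((((SameOff.refl _ _ _).setNat _ _ _).setReal _ _ _).setNat _ _ _).setNat _ _ _
    have e2 := hs₁.nats 2 (by simp)
    have e3 := hs₁.nats 3 (by simp)
    have e4 := hs₁.reals 4 (by simp)
    have e8 : (minPlusStart.exec σ).nats 8 0 = σ.nats 3 0 % (σ.nats 2 0 + 1) := by
      rw [minPlusStart_exec]
      simp
    have e5 (i) (hi : i ≠ σ.nats 3 0) : (minPlusStart.exec σ).reals 5 i = σ.reals 5 i := by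
      rw [minPlusStart_exec]
      simp [hi]
    have e10 (i) (hi : i ≠ σ.nats 3 0) : (minPlusStart.exec σ).nats 10 i = σ.nats 10 i := by
      rw [minPlusStart_exec]
      simp [hi]
    have e5' (i) (hi : i ≠ σ.nats 3 0) : τ₂.reals 5 i = σ.reals 5 i :=
      (h7 i (by rwa [e3])).trans (e5 i hi)
    rw [e3, e8] at h8 h9 h10
    have hcand (d) : (minPlusStart.exec σ).candidate (σ.nats 3 0)
        (σ.nats 3 0 % (σ.nats 2 0 + 1)) d = τ₂.reals 5 (σ.nats 3 0 - (σ.nats 2 0 + 1) - d) +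
          σ.reals 4 (σ.nats 3 0 - (σ.nats 2 0 + 1) - σ.nats 3 0 % (σ.nats 2 0 + 1) + d) := by
      rw [State.candidate, e2, e4, e5 _ (by omega), e5' _ (by omega)]
    simp only [hcand] at h8 h10
    simp only [Program.exec_setNat, NatExpr.eval]
    refine ⟨(hs₁.trans (A'' := {3, 4, 8, 10}) (B'' := {5}) hs).setNat _ _ _, ?_, ?_, ?_, ?_⟩
    · simp [hs.nats 3, e3]
    · intro i hi
      simp only [State.nats_setNat]
      exact (h6 i (by rwa [e3])).trans (e10 i hi)
    · exact e5'
    · exact ⟨h8, h9, h10⟩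

theorem spec_minPlusTable :
    Spec minPlusTable
      (fun S σ => σ.nats 3 0 = σ.nats 2 0 + 1 ∧
        (σ.nats 0 0 * σ.nats 0 0 + 1) * (σ.nats 2 0 + 1) ≤ S)
      (fun _ σ τ => SameOff {3, 4, 8, 10} {5} σ τ ∧
        (∀ i ≤ σ.nats 2 0, τ.reals 5 i = σ.reals 5 i) ∧
        ∀ i, σ.nats 2 0 < i → i < (σ.nats 0 0 * σ.nats 0 0 + 1) * (σ.nats 2 0 + 1) →
          MinPlusAt (σ.nats 2 0) (σ.reals 4) (τ.reals 5) (τ.nats 10) i) := by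
  have hlt {σ₀ σ : State} (hs : SameOff {3, 4, 8, 10} {5} σ₀ σ)
      (hc : Test.Holds σ (.not (.natLe (.mul (.add classesExpr (.const 1)) widthExpr) (.var 3)))) :
      σ.nats 3 0 < (σ₀.nats 0 0 * σ₀.nats 0 0 + 1) * (σ₀.nats 2 0 + 1) := by
    simpa [Test.Holds, NatExpr.eval, hs.nats 0, hs.nats 2] using hc
  have hloop := Spec.loop
    (c := .not (.natLe (.mul (.add classesExpr (.const 1)) widthExpr) (.var 3)))
    (Pre := fun S σ => σ.nats 3 0 = σ.nats 2 0 + 1 ∧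
        (σ.nats 0 0 * σ.nats 0 0 + 1) * (σ.nats 2 0 + 1) ≤ S) spec_minPlusEntry
    (Inv := fun _ σ τ => SameOff {3, 4, 8, 10} {5} σ τ ∧ σ.nats 2 0 + 1 ≤ τ.nats 3 0 ∧
      (∀ i ≤ σ.nats 2 0, τ.reals 5 i = σ.reals 5 i) ∧
      ∀ i, σ.nats 2 0 < i → i < τ.nats 3 0 →
          MinPlusAt (σ.nats 2 0) (σ.reals 4) (τ.reals 5) (τ.nats 10) i)
    (fun _ σ₀ σ => (σ₀.nats 0 0 * σ₀.nats 0 0 + 1) * (σ₀.nats 2 0 + 1) - σ.nats 3 0)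
    (fun S σ hσ h => ⟨.refl _ _ _, h.1.ge, fun _ _ => rfl, by omega⟩)
    (fun S σ₀ σ hσ h hI => by omega)
    (fun S σ₀ σ hσ h hI hc => ⟨by rw [hI.1.nats 2 (by simp)]; exact hI.2.1,
      (hlt hI.1 hc).trans_le h.2⟩) (by
      rintro S σ₀ σ τ hσ hτ hP ⟨hs, h1, h2, h3⟩ hc ⟨hs', h4, h5, h6, h7⟩
      have h8 := hlt hs hc
      refine ⟨⟨hs.trans hs', by omega, fun i hi => ?_, fun i hi hi' => ?_⟩, by omega⟩
      · rw [h6 i (by omega), h2 i hi]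
      · rw [h4] at hi'
        rcases (Nat.lt_succ_iff.1 hi').eq_or_lt with rfl | hi'
        · rwa [hs.nats 2 (by simp), hs.reals 4 (by simp)] at h7
        · exact (h3 i hi hi').congr (fun k hk => h6 k (by omega)) (h5 i (by omega)))
  refine hloop.consequence (fun _ _ _ h => h) ?_
  rintro S σ τ hσ hτ hP ⟨⟨hs, h1, h2, h3⟩, hc⟩
  have : (σ.nats 0 0 * σ.nats 0 0 + 1) * (σ.nats 2 0 + 1) ≤ τ.nats 3 0 := by
    simpa [Test.Holds, NatExpr.eval, hs.nats 0, hs.nats 2] using hc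
  exact ⟨hs, h2, fun i hi hi' => h3 i hi (by omega)⟩

/-- Translation of the truncated index arithmetic of the flat table into row and column coordinates.
-/
theorem MinPlusAt.eq_of_mul_add {N k q : ℕ} {W D : ℕ → ℝ} {ch : ℕ → ℕ}
    (h : MinPlusAt N W D ch ((k + 1) * (N + 1) + q)) (hq : q ≤ N) :
    ch ((k + 1) * (N + 1) + q) ≤ q ∧ D ((k + 1) * (N + 1) + q) =
      D (k * (N + 1) + (q - ch ((k + 1) * (N + 1) + q))) +
        W (k * (N + 1) + ch ((k + 1) * (N + 1) + q)) := by
  have hmod : ((k + 1) * (N + 1) + q) % (N + 1) = q := by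
    rw [Nat.mul_add_mod', Nat.mod_eq_of_lt (by omega)]
  have h1 := h.ch_le
  have h2 := h.eq
  have h3 : (k + 1) * (N + 1) = k * (N + 1) + (N + 1) := by ring
  rw [hmod] at h1 h2
  refine ⟨h1, h2.trans ?_⟩
  congr 2 <;> omega

theorem MinPlusAt.le_of_mul_add {N k q : ℕ} {W D : ℕ → ℝ} {ch : ℕ → ℕ}
    (h : MinPlusAt N W D ch ((k + 1) * (N + 1) + q)) (hq : q ≤ N) {d : ℕ} (hd : d ≤ q) :
    D ((k + 1) * (N + 1) + q) ≤ D (k * (N + 1) + (q - d)) + W (k * (N + 1) + d) := by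
  have hmod : ((k + 1) * (N + 1) + q) % (N + 1) = q := by
    rw [Nat.mul_add_mod', Nat.mod_eq_of_lt (by omega)]
  have h2 := h.le d (by omega)
  have h3 : (k + 1) * (N + 1) = k * (N + 1) + (N + 1) := by ring
  rw [hmod] at h2
  refine h2.trans_eq ?_
  congr 2 <;> omega

/-- One step of `traceback`. -/
def tracebackStep : Program :=
  .seq (.assign 4 (.load 10 (.add (.mul (.var 3) widthExpr) (.var 8))))
    (.seq (.assign 3 (.sub (.var 3) (.const 1)))
      (.seq (.setNat 1 (.var 3) (.load 9 (.add (.mul (.var 3) widthExpr) (.var 4))))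
        (.assign 8 (.sub (.var 8) (.var 4)))))

/-- Read an optimal choice for row `n` and the column in variable `8` off the tables. -/
def traceback : Program :=
  .seq (.assign 3 classesExpr) (.loop (.not (.natLe (.var 3) (.const 0))) tracebackStep)

theorem tracebackStep_exec (σ : State) {k d : ℕ} (h3 : σ.nats 3 0 = k + 1)
    (hd : σ.nats 10 ((k + 1) * (σ.nats 2 0 + 1) + σ.nats 8 0) = d) :
    tracebackStep.exec σ = (((σ.setNat 4 0 d).setNat 3 0 k).setNat 1 k
      (σ.nats 9 (k * (σ.nats 2 0 + 1) + d))).setNat 8 0 (σ.nats 8 0 - d) := by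
  simp [tracebackStep, Program.exec, NatExpr.eval, h3, hd]

/-- While the walk descends from the last row, the optimum equals the entry at the current position
plus the weights chosen so far. It ends in row zero, where all entries vanish. The units left over
there are why the chosen `d m` sum to at most, and not exactly, the requested column. -/
theorem spec_traceback :
    Spec traceback
      (fun S σ => σ.nats 0 0 * σ.nats 0 0 ≤ S ∧ σ.nats 8 0 ≤ σ.nats 2 0 ∧
        (∀ i ≤ σ.nats 2 0, σ.reals 5 i = 0) ∧
        ∀ i, σ.nats 2 0 < i → i < (σ.nats 0 0 * σ.nats 0 0 + 1) * (σ.nats 2 0 + 1) →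
          MinPlusAt (σ.nats 2 0) (σ.reals 4) (σ.reals 5) (σ.nats 10) i)
      (fun _ σ τ => ∃ d : ℕ → ℕ,
        ∑ m ∈ Finset.range (σ.nats 0 0 * σ.nats 0 0), d m ≤ σ.nats 8 0 ∧
        σ.reals 5 (σ.nats 0 0 * σ.nats 0 0 * (σ.nats 2 0 + 1) + σ.nats 8 0) =
          ∑ m ∈ Finset.range (σ.nats 0 0 * σ.nats 0 0),
            σ.reals 4 (m * (σ.nats 2 0 + 1) + d m) ∧
        ∀ m < σ.nats 0 0 * σ.nats 0 0,
          τ.nats 1 m = σ.nats 9 (m * (σ.nats 2 0 + 1) + d m)) := by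
  have hbody := Spec.ofLoopFree (p := tracebackStep) (Pre := fun _ _ => True)
    ⟨trivial, trivial, trivial, trivial⟩ (by
      intro S σ hσ _
      refine State.Bdd.setNat (State.Bdd.setNat (State.Bdd.setNat (hσ.setNat _ _ (hσ _ _)) _ _ ?_)
        _ _ ?_) _ _ ?_
      · simpa [NatExpr.eval, Program.exec] using
          (Nat.size_le_size (Nat.sub_le (σ.nats 3 0) 1)).trans (hσ 3 0)
      · simpa [NatExpr.eval, Program.exec] using hσ 9 _
      · simpa [NatExpr.eval, Program.exec] using
          (Nat.size_le_size (Nat.sub_le _ _)).trans (hσ 8 0))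
  have hinit := Spec.ofLoopFree (p := .assign 3 classesExpr)
    (Pre := fun S σ => σ.nats 0 0 * σ.nats 0 0 ≤ S ∧ σ.nats 8 0 ≤ σ.nats 2 0 ∧
        (∀ i ≤ σ.nats 2 0, σ.reals 5 i = 0) ∧
        ∀ i, σ.nats 2 0 < i → i < (σ.nats 0 0 * σ.nats 0 0 + 1) * (σ.nats 2 0 + 1) →
          MinPlusAt (σ.nats 2 0) (σ.reals 4) (σ.reals 5) (σ.nats 10) i) trivial
    fun S σ hσ h => hσ.setNat _ _ ((size_le_self _).trans h.1)
  have hpos {σ : State} (h : Test.Holds σ (.not (.natLe (.var 3) (.const 0)))) :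
      σ.nats 3 0 ≠ 0 := by
    simpa [Test.Holds, NatExpr.eval] using h
  have hloop := Spec.loop (c := .not (.natLe (.var 3) (.const 0)))
    (Pre := fun S σ => σ.nats 3 0 = σ.nats 0 0 * σ.nats 0 0 ∧
        σ.nats 0 0 * σ.nats 0 0 ≤ S ∧ σ.nats 8 0 ≤ σ.nats 2 0 ∧
        (∀ i ≤ σ.nats 2 0, σ.reals 5 i = 0) ∧
        ∀ i, σ.nats 2 0 < i → i < (σ.nats 0 0 * σ.nats 0 0 + 1) * (σ.nats 2 0 + 1) →
          MinPlusAt (σ.nats 2 0) (σ.reals 4) (σ.reals 5) (σ.nats 10) i) hbody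
    (Inv := fun _ σ τ => SameOff {1, 3, 4, 8} ∅ σ τ ∧ τ.nats 3 0 ≤ σ.nats 0 0 * σ.nats 0 0 ∧
      τ.nats 8 0 ≤ σ.nats 2 0 ∧ ∃ d : ℕ → ℕ,
        ∑ m ∈ Finset.Ico (τ.nats 3 0) (σ.nats 0 0 * σ.nats 0 0), d m + τ.nats 8 0 ≤ σ.nats 8 0 ∧
        σ.reals 5 (σ.nats 0 0 * σ.nats 0 0 * (σ.nats 2 0 + 1) + σ.nats 8 0) =
          σ.reals 5 (τ.nats 3 0 * (σ.nats 2 0 + 1) + τ.nats 8 0) +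
          ∑ m ∈ Finset.Ico (τ.nats 3 0) (σ.nats 0 0 * σ.nats 0 0),
            σ.reals 4 (m * (σ.nats 2 0 + 1) + d m) ∧
        ∀ m, τ.nats 3 0 ≤ m → m < σ.nats 0 0 * σ.nats 0 0 →
          τ.nats 1 m = σ.nats 9 (m * (σ.nats 2 0 + 1) + d m))
    (fun _ _ σ => σ.nats 3 0)
    (fun S σ hσ h => ⟨.refl _ _ _, h.1.le, h.2.2.1, fun _ => 0, by simp [h.1], by simp [h.1],
      by omega⟩)
    (fun S σ₀ σ hσ h hI => hI.2.1.trans h.2.1)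
    (fun S σ₀ σ hσ h hI hc => trivial) (by
      rintro S σ₀ σ τ hσ hτ ⟨-, -, -, -, hT⟩ ⟨hs, h1, h2, d, h3, h4, h5⟩ hc rfl
      obtain ⟨k, hk⟩ := Nat.exists_eq_add_one_of_ne_zero (hpos hc)
      have e2 := hs.nats 2 (by simp)
      have e9 := hs.nats 9 (by simp)
      have e10 := hs.nats 10 (by simp)
      rw [tracebackStep_exec σ hk rfl, e2, e9, e10]
      set n := σ₀.nats 0 0 * σ₀.nats 0 0 with hn
      set N := σ₀.nats 2 0 with hN
      set q := σ.nats 8 0 with hq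
      rw [hk] at h1 h3 h4 h5
      obtain ⟨h6, h7⟩ := (hT ((k + 1) * (N + 1) + q) (by nlinarith) (by
        have : (k + 1) * (N + 1) ≤ n * (N + 1) := Nat.mul_le_mul_right _ h1
        rw [add_mul n]
        omega)).eq_of_mul_add h2
      set e := σ₀.nats 10 ((k + 1) * (N + 1) + q) with he
      -- Stated for a general summand, as it is applied both to the units and to the real weights.
      have hsum {M : Type} [AddCommMonoid M] (g : ℕ → ℕ → M) :
          ∑ m ∈ Finset.Ico k n, g m (Function.update d k e m)
            = g k e + ∑ m ∈ Finset.Ico (k + 1) n, g m (d m) := by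
        rw [Finset.sum_eq_sum_Ico_succ_bot (by omega), Function.update_self]
        congr 1
        refine Finset.sum_congr rfl fun m hm => ?_
        rw [Function.update_of_ne (by have := Finset.mem_Ico.1 hm; omega)]
      refine ⟨⟨(((hs.setNat _ _ _).setNat _ _ _).setNat _ _ _).setNat _ _ _, ?_, ?_,
        Function.update d k e, ?_, ?_, ?_⟩, ?_⟩
      · simp; omega
      · simp; omega
      · simp [hsum fun _ x => x]; omega
      · simp [hsum fun m x => σ₀.reals 4 (m * (N + 1) + x)]
        rw [h4, h7, add_assoc]
      · intro m hm hm'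
        replace hm : k ≤ m := by simpa using hm
        rcases hm.eq_or_lt with rfl | hm
        · simp
        · simpa [Function.update_apply, hm.ne'] using h5 m hm hm'
      · simp; omega)
  refine (hinit.seq hloop ?_).consequence (fun _ _ _ h => h) ?_
  · rintro S σ τ hσ hτ h rfl
    simpa [Program.exec_setNat, NatExpr.eval] using h
  · rintro S σ υ hσ hυ ⟨-, h8, h0, -⟩ ⟨τ, -, rfl, ⟨hs, h1, h2, d, h3, h4, h5⟩, hc⟩
    have hυ : υ.nats 3 0 = 0 := by simpa [Test.Holds, NatExpr.eval] using hc
    have hs₁ := (SameOff.refl {3} ∅ σ).setNat 3 0 (σ.nats 0 0 * σ.nats 0 0)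
    refine ⟨d, ?_⟩
    simp only [Program.exec_setNat, NatExpr.eval, hs₁.nats 0 (by simp), hs₁.nats 2 (by simp),
      hs₁.nats 8 (by simp), hs₁.nats 9 (by simp), hυ, State.reals_setNat,
      Nat.Ico_zero_eq_range] at h2 h3 h4 h5
    rw [zero_mul, zero_add, h0 _ h2, zero_add] at h4
    exact ⟨by omega, h4, fun m hm => h5 m (Nat.zero_le _) hm⟩

/-- The half of the correctness of the dynamic program that the traceback does not give. By
induction on the rows: the last class takes `d m`, and the earlier ones fit into the remaining `q -
d m`. -/
theorem table_le_sum {n N : ℕ} {W D : ℕ → ℝ} {ch : ℕ → ℕ} (h0 : ∀ i ≤ N, D i = 0)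
    (h : ∀ i, N < i → i < (n + 1) * (N + 1) → MinPlusAt N W D ch i) (d : ℕ → ℕ) {m : ℕ} :
    m ≤ n → ∀ q ≤ N, ∑ i ∈ Finset.range m, d i ≤ q →
      D (m * (N + 1) + q) ≤ ∑ i ∈ Finset.range m, W (i * (N + 1) + d i) := by
  induction m with
  | zero => intro _ q hq _; simp [h0 q hq]
  | succ m ih =>
    intro hm q hq hs
    rw [Finset.sum_range_succ] at hs ⊢
    have h1 := (h ((m + 1) * (N + 1) + q) (by nlinarith) (by
      have : (m + 1) * (N + 1) ≤ n * (N + 1) := Nat.mul_le_mul_right _ hm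
      rw [add_mul n]
      omega)).le_of_mul_add hq (d := d m) (by omega)
    have h2 := ih (by omega) (q - d m) (by omega) (by omega)
    linarith

end RealRAM

/-! ## The multiple-choice knapsack problem -/

namespace Knapsack

open RealRAM

/-- Exact optimization: if `K m d` is the largest admissible rate of class `m` with cost at most
`d`, then a distribution `d` of the budget that minimizes the total negative value yields an
optimal policy. -/
theorem exact_optimal {n R N : ℕ} {a : ℕ → ℝ} {v : ℕ → ℕ → ℝ} (ha : ∀ m, 0 ≤ a m)
    (hv : ∀ m, Monotone (v m)) (hint : ∀ m < n, ∃ c : ℕ, a m = c) {K : ℕ → ℕ → ℕ}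
    (hK : ∀ m < n, ∀ d ≤ N, IsCutoff R (fun k => ¬ ((k + 1 : ℝ) * a m ≤ d)) (K m d))
    {d : ℕ → ℕ} (hd : ∑ m ∈ Finset.range n, d m ≤ N)
    (hmin : ∀ d' : ℕ → ℕ, ∑ m ∈ Finset.range n, d' m ≤ N →
      ∑ m ∈ Finset.range n, -v m (K m (d m)) ≤ ∑ m ∈ Finset.range n, -v m (K m (d' m))) :
    ∑ m ∈ Finset.range n, (K m (d m) : ℝ) * a m ≤ N ∧
      ∀ y : ℕ → ℕ, (∀ m < n, y m ≤ R) → ∑ m ∈ Finset.range n, (y m : ℝ) * a m ≤ N →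
        ∑ m ∈ Finset.range n, v m (y m) ≤ ∑ m ∈ Finset.range n, v m (K m (d m)) := by
  have hle {e : ℕ → ℕ} (he : ∑ m ∈ Finset.range n, e m ≤ N) (m) (hm : m < n) : e m ≤ N :=
    (Finset.single_le_sum (f := e) (fun _ _ => Nat.zero_le _) (Finset.mem_range.2 hm)).trans he
  constructor
  · calc ∑ m ∈ Finset.range n, (K m (d m) : ℝ) * a m ≤ ∑ m ∈ Finset.range n, (d m : ℝ) := by
          refine Finset.sum_le_sum fun m hm => ?_
          rw [Finset.mem_range] at hm
          rcases Nat.eq_zero_or_pos (K m (d m)) with h | h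
          · simp [h]
          -- The test at `k` speaks of the rate `k + 1`, so its failure at `K - 1` says that the
          -- rate `K` is affordable.
          · have := not_not.1 ((hK m hm _ (hle hd m hm)).pred h)
            rwa [Nat.cast_sub h, Nat.cast_one, sub_add_cancel] at this
      _ ≤ N := by exact_mod_cast hd
  · intro y hy hyN
    choose! c hc using hint
    have hsum : ∑ m ∈ Finset.range n, y m * c m ≤ N := by
      have : (∑ m ∈ Finset.range n, (y m : ℝ) * a m) =
          ((∑ m ∈ Finset.range n, y m * c m : ℕ) : ℝ) := by
        push_cast
        exact Finset.sum_congr rfl fun m hm => by rw [hc m (Finset.mem_range.1 hm)]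
      rw [this] at hyN
      exact_mod_cast hyN
    -- The competing distribution gives every class exactly what `y` spends on it; it is integral
    -- because the costs are.
    have h1 := hmin _ hsum
    simp only [Finset.sum_neg_distrib, neg_le_neg_iff] at h1
    refine le_trans (Finset.sum_le_sum fun m hm => hv m ?_) h1
    rw [Finset.mem_range] at hm
    by_contra! hlt
    have h2 := (hK m hm _ (hle hsum m hm)).self (hlt.trans_le (hy m hm))
    refine h2 ?_
    push_cast
    rw [← hc m hm]
    exact mul_le_mul_of_nonneg_right (by exact_mod_cast hlt) (ha m)

/-- Approximate optimization: let `L` be the largest value of a single affordable item, and let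
`K m d` be the least rate of class `m` whose value is at least `L` up to `d` units of size
`L / Q`, with cost `W m d`. If `q` is the least total number of units for which the budget
suffices, then a corresponding policy is optimal up to `n * (L / Q)`. -/
theorem approx_optimal {n R Q N : ℕ} {B L : ℝ} {a : ℕ → ℝ} {v : ℕ → ℕ → ℝ} (ha : ∀ m, 0 ≤ a m)
    (hv : ∀ m, Monotone (v m)) (hv0 : ∀ m k, 0 ≤ v m k) (hQ : 0 < n → 0 < Q) (hL : 0 ≤ L)
    (hN : N = n * Q)
    (hLmax : ∀ m < n, ∀ k ≤ R, (k : ℝ) * a m ≤ B → v m k ≤ L) {K : ℕ → ℕ → ℕ}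
    (hK : ∀ m < n, ∀ d ≤ N, IsCutoff R (fun k => L ≤ v m k + d * (L / Q)) (K m d))
    {W : ℕ → ℕ → ℝ}
    (hW : ∀ m < n, ∀ d ≤ N, L ≤ v m (K m d) + d * (L / Q) → W m d = K m d * a m)
    (hW' : ∀ m < n, ∀ d ≤ N, ¬ L ≤ v m (K m d) + d * (L / Q) → W m d = B + 1)
    (hB : 0 ≤ B) {q : ℕ} (hq : q ≤ N) {d : ℕ → ℕ} (hd : ∑ m ∈ Finset.range n, d m ≤ q)
    (hdB : ∑ m ∈ Finset.range n, W m (d m) ≤ B)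
    (hmin : ∀ d' : ℕ → ℕ, ∑ m ∈ Finset.range n, d' m ≤ N →
      ∑ m ∈ Finset.range n, W m (d' m) ≤ B → q ≤ ∑ m ∈ Finset.range n, d' m) :
    ∑ m ∈ Finset.range n, (K m (d m) : ℝ) * a m ≤ B ∧
      ∀ y : ℕ → ℕ, (∀ m < n, y m ≤ R) → ∑ m ∈ Finset.range n, (y m : ℝ) * a m ≤ B →
        ∑ m ∈ Finset.range n, v m (y m) ≤
          ∑ m ∈ Finset.range n, v m (K m (d m)) + n * (L / Q) := by
  have hdN (m) (hm : m < n) : d m ≤ N :=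
    ((Finset.single_le_sum (f := d) (fun _ _ => Nat.zero_le _)
      (Finset.mem_range.2 hm)).trans hd).trans hq
  have hW0 (m) (hm : m < n) : 0 ≤ W m (d m) := by
    by_cases h : L ≤ v m (K m (d m)) + d m * (L / Q)
    · rw [hW m hm _ (hdN m hm) h]
      exact mul_nonneg (Nat.cast_nonneg _) (ha m)
    · rw [hW' m hm _ (hdN m hm) h]
      linarith
  -- A single weight `B + 1` would exceed the budget, since all other weights are nonnegative.
  have hvalid (m) (hm : m < n) : L ≤ v m (K m (d m)) + d m * (L / Q) := by
    by_contra h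
    have h1 := Finset.single_le_sum (f := fun m => W m (d m))
      (fun m hm => hW0 m (Finset.mem_range.1 hm)) (Finset.mem_range.2 hm)
    simp only [hW' m hm _ (hdN m hm) h] at h1
    linarith
  constructor
  · refine le_trans (Finset.sum_le_sum fun m hm => ?_) hdB
    rw [Finset.mem_range] at hm
    exact (hW m hm _ (hdN m hm) (hvalid m hm)).ge
  · intro y hy hyB
    have hδ : 0 ≤ L / Q := by positivity
    -- `e` is the deficit of `y` in class `m`, rounded up to whole units. Nonnegative values give `e
    -- ≤ Q`, and minimality of `e` makes the overshoot at most one unit, which is the only loss in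
    -- the argument.
    have hex (m : ℕ) (hm : m < n) : ∃ e : ℕ, L ≤ v m (y m) + e * (L / Q) ∧ e ≤ Q ∧
        v m (y m) + e * (L / Q) ≤ L + L / Q := by
      have hQ' : (Q : ℝ) ≠ 0 := by
        have := hQ (by omega)
        positivity
      have hyL : v m (y m) ≤ L := by
        refine hLmax m hm _ (hy m hm) (le_trans ?_ hyB)
        exact Finset.single_le_sum (f := fun m => (y m : ℝ) * a m)
          (fun m _ => mul_nonneg (Nat.cast_nonneg _) (ha m)) (Finset.mem_range.2 hm)
      have hQL : L ≤ v m (y m) + Q * (L / Q) := by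
        rw [mul_div_cancel₀ _ hQ']
        linarith [hv0 m (y m)]
      classical
      have hex : ∃ e : ℕ, L ≤ v m (y m) + e * (L / Q) := ⟨Q, hQL⟩
      refine ⟨Nat.find hex, Nat.find_spec hex, Nat.find_min' hex hQL, ?_⟩
      rcases Nat.eq_zero_or_pos (Nat.find hex) with h | h
      · rw [h]
        push_cast
        linarith
      · have h1 := Nat.find_min hex (Nat.sub_lt h one_pos)
        rw [not_le, Nat.cast_sub (show 1 ≤ Nat.find hex from h), Nat.cast_one] at h1
        linarith
    choose! e he heQ hle using hex
    have heN : ∑ m ∈ Finset.range n, e m ≤ N := by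
      rw [hN]
      refine (Finset.sum_le_sum fun m hm => heQ m (Finset.mem_range.1 hm)).trans ?_
      simp
    have heN' (m) (hm : m < n) : e m ≤ N :=
      (Finset.single_le_sum (f := e) (fun _ _ => Nat.zero_le _) (Finset.mem_range.2 hm)).trans heN
    have hWe (m) (hm : m < n) : W m (e m) ≤ y m * a m := by
      have hc := hK m hm _ (heN' m hm)
      have hKy : K m (e m) ≤ y m := by
        by_contra! hlt
        have h1 := hv m (show y m ≤ K m (e m) - 1 by omega)
        exact hc.pred (by omega) (by linarith [he m hm])
      rw [hW m hm _ (heN' m hm)]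
      · exact mul_le_mul_of_nonneg_right (by exact_mod_cast hKy) (ha m)
      -- A cutoff equal to `R` carries no information about the predicate at `R`; in that case `y m
      -- = R`, and `y` itself reaches the required value.
      · rcases hc.le.lt_or_eq with h | h
        · exact hc.self h
        · rw [le_antisymm hKy ((hy m hm).trans h.ge)]
          exact he m hm
    have hqe := hmin e heN
      ((Finset.sum_le_sum fun m hm => hWe m (Finset.mem_range.1 hm)).trans hyB)
    -- Both policies are compared with `n * L`: `y` plus its deficits is at most `n * (L + L / Q)`,
    -- the computed policy plus its deficits is at least `n * L`, and its total deficit is no larger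
    -- than that of `y`.
    have h1 : ∑ m ∈ Finset.range n, (v m (y m) + e m * (L / Q)) ≤
        ∑ m ∈ Finset.range n, (L + L / Q) :=
      Finset.sum_le_sum fun m hm => hle m (Finset.mem_range.1 hm)
    have h2 : ∑ m ∈ Finset.range n, L ≤
        ∑ m ∈ Finset.range n, (v m (K m (d m)) + d m * (L / Q)) :=
      Finset.sum_le_sum fun m hm => hvalid m (Finset.mem_range.1 hm)
    have h3 : (∑ m ∈ Finset.range n, (d m : ℝ)) * (L / Q) ≤
        (∑ m ∈ Finset.range n, (e m : ℝ)) * (L / Q) :=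
      mul_le_mul_of_nonneg_right (by exact_mod_cast hd.trans hqe) hδ
    rw [Finset.sum_add_distrib, ← Finset.sum_mul] at h1 h2
    simp only [Finset.sum_add_distrib, Finset.sum_const, Finset.card_range, nsmul_eq_mul] at h1 h2
    linarith

end Knapsack

/-! ### Instances as knapsacks: ordered pairs numbered as classes -/

namespace SyncInstance

/-- `0` on the diagonal and `1` elsewhere. -/
noncomputable def offDiag (C m : ℕ) : ℝ := if m / C = m % C then 0 else 1

end SyncInstance

namespace RealRAM

/-- The cost of a message of class `m`. -/
noncomputable def State.unitCost (σ : State) (m : ℕ) : ℝ :=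
  SyncInstance.offDiag (σ.nats 0 0) m * σ.reals 1 m

/-- The contribution of class `m` to the consistency level at rate `k`. -/
noncomputable def State.value (σ : State) (m k : ℕ) : ℝ :=
  SyncInstance.offDiag (σ.nats 0 0) m *
    Real.exp (-(σ.reals 0 (m / σ.nats 0 0) * σ.reals 2 0 / ((k : ℝ) + 1)))

end RealRAM

namespace SyncInstance

theorem sum_range_eq (C : ℕ) (f : ℕ → ℝ) :
    ∑ m ∈ Finset.range (C * C), f m = ∑ i : Fin C, ∑ j : Fin C, f (j + C * i) := by
  rw [Finset.sum_range, ← Equiv.sum_comp finProdFinEquiv, Fintype.sum_prod_type]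
  rfl

theorem offDiag_add_mul {C : ℕ} (i j : Fin C) :
    offDiag C (j + C * i) = if j = i then 0 else 1 := by
  have hC : 0 < C := i.pos
  rw [offDiag, Nat.add_mul_div_left _ _ hC, Nat.add_mul_mod_self_left, Nat.div_eq_of_lt j.2,
    Nat.mod_eq_of_lt j.2, zero_add]
  simp only [Fin.ext_iff, eq_comm]

variable (I : SyncInstance) (ε : ℝ)

theorem unitCost_inputState (i j : Fin I.C) :
    (I.inputState ε).unitCost (j + I.C * i) = if j = i then 0 else I.b i j := by
  have h : (j : ℕ) + I.C * i < I.C * I.C := (finProdFinEquiv (i, j)).2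
  have h' : finProdFinEquiv.symm (⟨j + I.C * i, h⟩ : Fin (I.C * I.C)) = (i, j) :=
    (Equiv.symm_apply_eq _).2 rfl
  rw [RealRAM.State.unitCost]
  simp only [inputState, offDiag_add_mul, dif_pos h, h']
  split_ifs <;> simp

theorem value_inputState (i j : Fin I.C) (k : ℕ) :
    (I.inputState ε).value (j + I.C * i) k =
      if j = i then 0 else Real.exp (-(I.lam i * I.s / ((k : ℝ) + 1))) := by
  have hC : 0 < I.C := i.pos
  have h : ((j : ℕ) + I.C * i) / I.C = i := by
    rw [Nat.add_mul_div_left _ _ hC, Nat.div_eq_of_lt j.2, zero_add]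
  rw [RealRAM.State.value]
  simp only [inputState, offDiag_add_mul, h, dif_pos i.2]
  split_ifs <;> simp

theorem sum_unitCost (x : ℕ → ℕ) :
    ∑ m ∈ Finset.range (I.C * I.C), (x m : ℝ) * (I.inputState ε).unitCost m =
      ∑ i : Fin I.C, ∑ j : Fin I.C with j ≠ i, (x (j + I.C * i) : ℝ) * I.b i j := by
  rw [sum_range_eq]
  refine Finset.sum_congr rfl fun i _ => ?_
  rw [Finset.sum_filter]
  refine Finset.sum_congr rfl fun j _ => ?_
  rw [unitCost_inputState]
  split_ifs <;> simp_all

theorem sum_value (x : ℕ → ℕ) :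
    ∑ m ∈ Finset.range (I.C * I.C), (I.inputState ε).value m (x m) =
      I.consistencyLevel fun i j => x (j + I.C * i) := by
  rw [sum_range_eq, consistencyLevel]
  refine Finset.sum_congr rfl fun i _ => ?_
  rw [Finset.sum_filter]
  refine Finset.sum_congr rfl fun j _ => ?_
  rw [value_inputState]
  split_ifs <;> simp_all

/-- Feasibility does not restrict the diagonal of `y`, which may exceed `R`. Setting it to zero
changes neither the cost nor the consistency level. -/
theorem exists_rates {y : I.Policy} (hy : I.Feasible y) :
    ∃ x : ℕ → ℕ, (∀ m < I.C * I.C, x m ≤ I.R) ∧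
      ∑ m ∈ Finset.range (I.C * I.C), (x m : ℝ) * (I.inputState ε).unitCost m ≤ I.B ∧
      ∑ m ∈ Finset.range (I.C * I.C), (I.inputState ε).value m (x m) = I.consistencyLevel y := by
  let x (m : ℕ) : ℕ := if h : m < I.C * I.C then
    let p := finProdFinEquiv.symm (⟨m, h⟩ : Fin (I.C * I.C))
    if p.2 = p.1 then 0 else y p.1 p.2 else 0
  have hx (i j : Fin I.C) : x (j + I.C * i) = if j = i then 0 else y i j := by
    have h : (j : ℕ) + I.C * i < I.C * I.C := (finProdFinEquiv (i, j)).2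
    have h' : finProdFinEquiv.symm (⟨j + I.C * i, h⟩ : Fin (I.C * I.C)) = (i, j) :=
      (Equiv.symm_apply_eq _).2 rfl
    simp only [x, dif_pos h, h']
  refine ⟨x, fun m hm => ?_, ?_, ?_⟩
  · simp only [x, dif_pos hm]
    split_ifs with h
    · exact Nat.zero_le _
    · exact hy.1 _ _ h
  · rw [sum_unitCost]
    refine le_of_eq_of_le (Finset.sum_congr rfl fun i _ => Finset.sum_congr rfl fun j hj => ?_) hy.2
    rw [hx, if_neg (Finset.mem_filter.1 hj).2]
  · rw [sum_value]
    refine Finset.sum_congr rfl fun i _ => Finset.sum_congr rfl fun j hj => ?_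
    simp only [hx, if_neg (Finset.mem_filter.1 hj).2]

/-- The diagonal of `b` may be negative, but the factor `offDiag` removes it; outside the matrix the
memory is zero. -/
theorem unitCost_nonneg (m : ℕ) : 0 ≤ (I.inputState ε).unitCost m := by
  by_cases h : m < I.C * I.C
  · obtain ⟨⟨i, j⟩, hij⟩ := finProdFinEquiv.surjective (⟨m, h⟩ : Fin (I.C * I.C))
    have : m = j + I.C * i := (congrArg Fin.val hij).symm
    rw [this, unitCost_inputState]
    split_ifs with hji
    · exact le_rfl
    · exact I.b_nonneg i j hji
  · simp [RealRAM.State.unitCost, inputState, h]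

theorem value_monotone (m : ℕ) : Monotone ((I.inputState ε).value m) := by
  intro k l hkl
  refine mul_le_mul_of_nonneg_left ?_ ?_
  · rw [Real.exp_le_exp, neg_le_neg_iff]
    have h : 0 ≤ (I.inputState ε).reals 0 (m / (I.inputState ε).nats 0 0) *
        (I.inputState ε).reals 2 0 := by
      refine mul_nonneg ?_ I.s_pos.le
      simp only [inputState]
      split_ifs with h
      · exact I.lam_nonneg _
      · exact le_rfl
    gcongr
  · rw [offDiag]
    split_ifs <;> norm_num

theorem exists_unitCost_eq (hI : I.IsIntegral) (m : ℕ) (hm : m < I.C * I.C) :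
    ∃ c : ℕ, (I.inputState ε).unitCost m = c := by
  obtain ⟨⟨i, j⟩, hij⟩ := finProdFinEquiv.surjective (⟨m, hm⟩ : Fin (I.C * I.C))
  have : m = j + I.C * i := (congrArg Fin.val hij).symm
  rw [this, unitCost_inputState]
  split_ifs with hji
  · exact ⟨0, by simp⟩
  · exact hI.1 i j hji

theorem feasible_outputPolicy {τ : RealRAM.State} (hR : ∀ m < I.C * I.C, τ.nats 1 m ≤ I.R)
    (hB : ∑ m ∈ Finset.range (I.C * I.C), (τ.nats 1 m : ℝ) * (I.inputState ε).unitCost m ≤ I.B) :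
    I.Feasible (I.outputPolicy τ) :=
  ⟨fun i j _ => hR _ (finProdFinEquiv (i, j)).2, (I.sum_unitCost ε (τ.nats 1)).ge.trans hB⟩

theorem consistencyLevel_outputPolicy (τ : RealRAM.State) :
    I.consistencyLevel (I.outputPolicy τ) =
      ∑ m ∈ Finset.range (I.C * I.C), (I.inputState ε).value m (τ.nats 1 m) :=
  (I.sum_value ε (τ.nats 1)).symm

theorem bdd_inputState {S : ℕ} (hC : Nat.size I.C ≤ S) (hR : Nat.size I.R ≤ S) :
    (I.inputState ε).Bdd S := by
  intro a k
  simp only [inputState]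
  split <;> simp_all

end SyncInstance

/-! ### Composition of specifications and frame lemmas -/

namespace RealRAM

theorem Spec.seq_of {p q : Program} {Pre Pre₁ Pre₂ : ℕ → State → Prop}
    {Post Post₁ Post₂ : ℕ → State → State → Prop} (hp : Spec p Pre₁ Post₁)
    (hq : Spec q Pre₂ Post₂) (h₁ : ∀ S σ, Pre S σ → Pre₁ S σ)
    (h₂ : ∀ S σ τ, Pre S σ → Post₁ S σ τ → Pre₂ S τ)
    (h : ∀ S σ τ υ, Pre S σ → Post₁ S σ τ → Post₂ S τ υ → Post S σ υ) :
    Spec (.seq p q) Pre Post := by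
  refine ((hp.consequence (fun S σ _ => h₁ S σ) fun _ _ _ _ _ _ h => h).seq hq
    fun S σ τ _ _ => h₂ S σ τ).consequence (fun _ _ _ h => h) ?_
  rintro S σ υ - - hP ⟨τ, -, h3, h4⟩
  exact h S σ τ υ hP h3 h4

theorem SameOff.mono {A B A' B' : Set ℕ} {σ τ : State} (h : SameOff A B σ τ)
    (hA : A ⊆ A' := by simp [Set.insert_subset_iff])
    (hB : B ⊆ B' := by simp [Set.insert_subset_iff]) : SameOff A' B' σ τ :=
  ⟨fun a ha => h.nats a fun h' => ha (hA h'), fun a ha => h.reals a fun h' => ha (hB h')⟩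

theorem SameOff.unitCost {A B : Set ℕ} {σ τ : State} (h : SameOff A B σ τ)
    (hA : 0 ∉ A := by simp) (hB : 1 ∉ B := by simp) : τ.unitCost = σ.unitCost := by
  funext m
  rw [State.unitCost, State.unitCost, h.nats 0 hA, h.reals 1 hB]

theorem SameOff.value {A B : Set ℕ} {σ τ : State} (h : SameOff A B σ τ)
    (hA : 0 ∉ A := by simp) (hB : 0 ∉ B := by simp) (hB' : 2 ∉ B := by simp) :
    τ.value = σ.value := by
  funext m k
  rw [State.value, State.value, h.nats 0 hA, h.reals 0 hB, h.reals 2 hB']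

/-! ## Expressions for costs and values -/

/-- The remainder of a division. -/
abbrev NatExpr.mod (e f : NatExpr) : NatExpr := .sub e (.mul f (.div e f))

theorem NatExpr.eval_mod (σ : State) (e f : NatExpr) :
    (NatExpr.mod e f).eval σ = e.eval σ % f.eval σ := by
  simp [NatExpr.eval, Nat.mod_eq_sub_mul_div]

/-- Whether a class is off the diagonal. -/
def offDiagExpr (m : NatExpr) : NatExpr :=
  .sub (.const 1) (.sub (.const 1)
    (.add (.sub (.div m (.load 0 (.const 0))) (.mod m (.load 0 (.const 0))))
      (.sub (.mod m (.load 0 (.const 0))) (.div m (.load 0 (.const 0))))))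

/-- The two truncated differences add up to the distance of row and column, and `1 - (1 - x)`
truncates a natural number to `0` or `1`. -/
theorem eval_offDiagExpr (σ : State) (m : NatExpr) :
    ((offDiagExpr m).eval σ : ℝ) = SyncInstance.offDiag (σ.nats 0 0) (m.eval σ) := by
  have h : (offDiagExpr m).eval σ = 1 - (1 - ((m.eval σ / σ.nats 0 0 - m.eval σ % σ.nats 0 0) +
      (m.eval σ % σ.nats 0 0 - m.eval σ / σ.nats 0 0))) := by
    simp [offDiagExpr, NatExpr.eval, Nat.mod_eq_sub_mul_div]
  rw [h, SyncInstance.offDiag]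
  split_ifs with h'
  · simp [h']
  · have : 1 - (1 - ((m.eval σ / σ.nats 0 0 - m.eval σ % σ.nats 0 0) +
      (m.eval σ % σ.nats 0 0 - m.eval σ / σ.nats 0 0))) = 1 := by omega
    rw [this, Nat.cast_one]

/-- The cost of a message of class `m`. -/
def unitCostExpr (m : NatExpr) : RealExpr := .mul (.ofNat (offDiagExpr m)) (.load 1 m)

@[simp] theorem eval_unitCostExpr (σ : State) (m : NatExpr) :
    (unitCostExpr m).eval σ = σ.unitCost (m.eval σ) := by
  simp [unitCostExpr, RealExpr.eval, eval_offDiagExpr, State.unitCost]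

/-- The contribution of class `m` to the consistency level at rate `k`. -/
def valueExpr (m k : NatExpr) : RealExpr :=
  .mul (.ofNat (offDiagExpr m)) (.exp (.sub (.ofNat (.const 0))
    (.div (.mul (.load 0 (.div m (.load 0 (.const 0)))) (.load 2 (.const 0)))
      (.ofNat (.add k (.const 1))))))

@[simp] theorem eval_valueExpr (σ : State) (m k : NatExpr) :
    (valueExpr m k).eval σ = σ.value (m.eval σ) (k.eval σ) := by
  simp [valueExpr, RealExpr.eval, NatExpr.eval, eval_offDiagExpr, State.value]

/-! ## Tables -/

/-- The class that belongs to the table index in variable `3`. -/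
abbrev rowExpr : NatExpr := .div (.var 3) widthExpr

/-- The column that belongs to the table index in variable `3`. -/
abbrev colExpr : NatExpr := .mod (.var 3) widthExpr

/-- Fill the tables `K` and `W`: the entries of `K` are cutoffs of the test `c`, those of `W` are
set by `g`. -/
def fill (c : Test) (g : Program) : Program :=
  forEach (.mul classesExpr widthExpr) c (.seq (.setNat 9 (.var 3) (.var 5)) g)

/-- Shared by both algorithms, which differ only in the predicate `T` of the search and in the
weight `w` computed from the rate found. -/
theorem spec_fill {c : Test} {g : Program} (hg : g.LoopFree) (T : State → ℕ → ℕ → Prop)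
    (w : State → ℕ → ℕ → ℝ)
    (hc : ∀ σ₀ σ, SameOff {3, 5, 6, 7, 9} {4} σ₀ σ →
      (c.Holds σ ↔ T σ₀ (σ.nats 3 0) (σ.nats 7 0)))
    (hexec : ∀ σ₀ σ, SameOff {3, 5, 6, 7, 9} {4} σ₀ σ →
      g.exec σ = σ.setReal 4 (σ.nats 3 0) (w σ₀ (σ.nats 3 0) (σ.nats 5 0))) :
    Spec (fill c g)
      (fun S σ => σ.nats 3 0 = 0 ∧ σ.nats 0 0 * σ.nats 0 0 * (σ.nats 2 0 + 1) ≤ S)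
      (fun _ σ τ => SameOff {3, 5, 6, 7, 9} {4} σ τ ∧
        ∀ i < σ.nats 0 0 * σ.nats 0 0 * (σ.nats 2 0 + 1),
          IsCutoff (σ.nats 0 1) (T σ i) (τ.nats 9 i) ∧ τ.reals 4 i = w σ i (τ.nats 9 i)) := by
  refine spec_forEach (f := .seq (.setNat 9 (.var 3) (.var 5)) g) ⟨trivial, hg⟩
    (fun σ m τ => SameOff {3, 5, 6, 7, 9} {4} σ τ ∧ ∀ i < m,
      IsCutoff (σ.nats 0 1) (T σ i) (τ.nats 9 i) ∧ τ.reals 4 i = w σ i (τ.nats 9 i)) T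
    (fun σ => σ.nats 0 0 * σ.nats 0 0 * (σ.nats 2 0 + 1)) (fun S σ₀ h => h.2) ?_ ?_ ?_ ?_ ?_ ?_
  · rintro S σ₀ m σ - ⟨hs, -⟩
    simp [NatExpr.eval, hs.nats 0, hs.nats 2]
  · rintro S σ₀ m σ - ⟨hs, -⟩
    exact hs.nats 0 (by simp)
  · rintro σ₀ m σ τ ⟨hs, h⟩ hs'
    refine ⟨hs.trans hs', ?_⟩
    rwa [hs'.nats 9 (by simp), hs'.reals 4 (by simp)]
  · exact fun S σ h => ⟨h.1, .refl _ _ _, by simp⟩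
  · rintro S σ₀ m σ - ⟨hs, -⟩ - rfl
    exact hc σ₀ σ hs
  · rintro S σ₀ m σ - ⟨hs, h⟩ - rfl hσ hcut
    have hs' := hs.setNat 9 (σ.nats 3 0) (σ.nats 5 0)
    rw [Program.exec_seq, Program.exec_setNat]
    simp only [NatExpr.eval]
    rw [hexec σ₀ _ hs']
    refine ⟨State.Bdd.setReal (hσ.setNat _ _ (hσ _ _)) _ _ _, ⟨hs'.setReal _ _ _, ?_⟩, ?_⟩
    · intro i hi
      simp
      rcases (Nat.lt_succ_iff.1 hi).eq_or_lt with rfl | hi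
      · simpa using hcut
      · simpa [Function.update_apply, hi.ne] using h i hi
    · simp

/-- The tables hold the solution of the dynamic program. -/
def State.Solved (σ : State) : Prop :=
  (∀ i ≤ σ.nats 2 0, σ.reals 5 i = 0) ∧
    ∀ i, σ.nats 2 0 < i → i < (σ.nats 0 0 * σ.nats 0 0 + 1) * (σ.nats 2 0 + 1) →
      MinPlusAt (σ.nats 2 0) (σ.reals 4) (σ.reals 5) (σ.nats 10) i

/-- The last row of the table of the dynamic program. -/
def State.opt (σ : State) (q : ℕ) : ℝ :=
  σ.reals 5 (σ.nats 0 0 * σ.nats 0 0 * (σ.nats 2 0 + 1) + q)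

theorem State.Solved.opt_le {σ : State} (h : σ.Solved) {d : ℕ → ℕ} {q : ℕ} (hq : q ≤ σ.nats 2 0)
    (hd : ∑ m ∈ Finset.range (σ.nats 0 0 * σ.nats 0 0), d m ≤ q) :
    σ.opt q ≤ ∑ m ∈ Finset.range (σ.nats 0 0 * σ.nats 0 0),
      σ.reals 4 (m * (σ.nats 2 0 + 1) + d m) :=
  table_le_sum h.1 h.2 d le_rfl q hq hd

/-- Solve the dynamic program. -/
def solve : Program := .seq (.assign 3 widthExpr) minPlusTable

/-- Row zero consists of zeros, which is the initial content of the array; the computation can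
therefore start at the first index of row one. -/
theorem spec_solve :
    Spec solve
      (fun S σ => (∀ i ≤ σ.nats 2 0, σ.reals 5 i = 0) ∧
        (σ.nats 0 0 * σ.nats 0 0 + 1) * (σ.nats 2 0 + 1) ≤ S)
      (fun _ σ τ => SameOff {3, 4, 8, 10} {5} σ τ ∧ τ.Solved) := by
  have hinit := Spec.ofLoopFree (p := .assign 3 widthExpr)
    (Pre := fun S σ => σ.nats 2 0 + 1 ≤ S) trivial fun S σ hσ h =>
      hσ.setNat _ _ ((size_le_self _).trans h)
  refine hinit.seq_of spec_minPlusTable ?_ ?_ ?_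
  · rintro S σ ⟨-, h⟩
    nlinarith [Nat.zero_le (σ.nats 0 0 * σ.nats 0 0 * (σ.nats 2 0 + 1))]
  · rintro S σ τ ⟨-, h⟩ rfl
    simpa [Program.exec_setNat, NatExpr.eval] using h
  · rintro S σ τ υ ⟨h0, -⟩ rfl ⟨hs, h1, h2⟩
    have hs' : SameOff {3} ∅ σ ((Program.assign 3 widthExpr).exec σ) :=
      (SameOff.refl {3} ∅ σ).setNat _ _ _
    refine ⟨hs'.trans hs, fun i hi => ?_, ?_⟩
    · rw [hs.nats 2 (by simp)] at hi
      rw [h1 i hi, hs'.reals 5 (by simp)]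
      rw [hs'.nats 2 (by simp)] at hi
      exact h0 i hi
    · rwa [hs.nats 2 (by simp), hs.nats 0 (by simp), hs.reals 4 (by simp)]

theorem spec_traceback_of_solved :
    Spec traceback
      (fun S σ => σ.nats 0 0 * σ.nats 0 0 ≤ S ∧ σ.nats 8 0 ≤ σ.nats 2 0 ∧ σ.Solved)
      (fun _ σ τ => ∃ d : ℕ → ℕ,
        ∑ m ∈ Finset.range (σ.nats 0 0 * σ.nats 0 0), d m ≤ σ.nats 8 0 ∧
        σ.opt (σ.nats 8 0) = ∑ m ∈ Finset.range (σ.nats 0 0 * σ.nats 0 0),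
            σ.reals 4 (m * (σ.nats 2 0 + 1) + d m) ∧
        ∀ m < σ.nats 0 0 * σ.nats 0 0,
          τ.nats 1 m = σ.nats 9 (m * (σ.nats 2 0 + 1) + d m)) := spec_traceback

/-- All working memory is zero. -/
structure State.Fresh (σ : State) : Prop where
  nats : ∀ a k, a ≠ 0 → σ.nats a k = 0
  reals : ∀ a k, 2 < a → σ.reals a k = 0

/-- The table index of a class and a column. -/
theorem mul_add_lt {n N m d : ℕ} (hm : m < n) (hd : d ≤ N) : m * (N + 1) + d < n * (N + 1) := by
  have : (m + 1) * (N + 1) ≤ n * (N + 1) := Nat.mul_le_mul_right _ hm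
  rw [add_mul] at this
  omega

theorem mul_add_div {N d : ℕ} (m : ℕ) (hd : d ≤ N) : (m * (N + 1) + d) / (N + 1) = m := by
  rw [mul_comm, Nat.mul_add_div (Nat.succ_pos N), Nat.div_eq_of_lt (by omega), add_zero]

theorem mul_add_mod {N d : ℕ} (m : ℕ) (hd : d ≤ N) : (m * (N + 1) + d) % (N + 1) = d := by
  rw [Nat.mul_add_mod', Nat.mod_eq_of_lt (by omega)]

/-! ## The pseudopolynomial algorithm -/

/-- The tables of the pseudopolynomial algorithm: `K` is the largest affordable rate. -/
def exactFill : Program :=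
  fill (.not (.realLe (.mul (.add (.ofNat (.var 7)) (.ofNat (.const 1))) (unitCostExpr rowExpr))
      (.ofNat colExpr)))
    (.setReal 4 (.var 3) (.sub (.ofNat (.const 0)) (valueExpr rowExpr (.var 5))))

theorem spec_exactFill :
    Spec exactFill
      (fun S σ => σ.nats 3 0 = 0 ∧ σ.nats 0 0 * σ.nats 0 0 * (σ.nats 2 0 + 1) ≤ S)
      (fun _ σ τ => SameOff {3, 5, 6, 7, 9} {4} σ τ ∧
        ∀ i < σ.nats 0 0 * σ.nats 0 0 * (σ.nats 2 0 + 1),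
          IsCutoff (σ.nats 0 1) (fun k => ¬ ((k + 1 : ℝ) * σ.unitCost (i / (σ.nats 2 0 + 1)) ≤
            (i % (σ.nats 2 0 + 1) : ℕ))) (τ.nats 9 i) ∧
          τ.reals 4 i = -σ.value (i / (σ.nats 2 0 + 1)) (τ.nats 9 i)) := by
  refine spec_fill (show Program.LoopFree (.setReal _ _ _) from trivial) _
    (fun σ i k => -σ.value (i / (σ.nats 2 0 + 1)) k) ?_ ?_
  · intro σ₀ σ hs
    have h2 := hs.nats 2 (by simp)
    simp only [Test.Holds, RealExpr.eval, eval_unitCostExpr, NatExpr.eval_mod, hs.unitCost]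
    simp only [NatExpr.eval, h2, Nat.cast_one]
  · intro σ₀ σ hs
    have h2 := hs.nats 2 (by simp)
    rw [Program.exec_setReal]
    simp only [RealExpr.eval, eval_valueExpr, hs.value]
    simp only [NatExpr.eval, h2, Nat.cast_zero, zero_sub]

/-- The pseudopolynomial algorithm. -/
def exactProgram : Program :=
  .seq (.seq (.seq (.seq
    (.loop (.not (.realLe (.load 2 (.const 1)) (.ofNat (.var 2))))
      (.assign 2 (.add (.var 2) (.const 1))))
    exactFill) solve) (.assign 8 (.var 2))) traceback

/-- The lower bound on `S` is the number of entries of the dynamic programming table, which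
dominates the number of rounds of the counting, filling and traceback loops as well. -/
theorem spec_exactProgram :
    Spec exactProgram
      (fun S σ => σ.Fresh ∧ (σ.nats 0 0 * σ.nats 0 0 + 1) * (⌈σ.reals 2 1⌉₊ + 1) ≤ S)
      (fun _ σ τ => ∃ (K : ℕ → ℕ → ℕ) (d : ℕ → ℕ),
        (∀ m < σ.nats 0 0 * σ.nats 0 0, ∀ d ≤ ⌈σ.reals 2 1⌉₊,
          IsCutoff (σ.nats 0 1) (fun k => ¬ ((k + 1 : ℝ) * σ.unitCost m ≤ d)) (K m d)) ∧
        ∑ m ∈ Finset.range (σ.nats 0 0 * σ.nats 0 0), d m ≤ ⌈σ.reals 2 1⌉₊ ∧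
        (∀ d' : ℕ → ℕ, ∑ m ∈ Finset.range (σ.nats 0 0 * σ.nats 0 0), d' m ≤ ⌈σ.reals 2 1⌉₊ →
          ∑ m ∈ Finset.range (σ.nats 0 0 * σ.nats 0 0), -σ.value m (K m (d m)) ≤
            ∑ m ∈ Finset.range (σ.nats 0 0 * σ.nats 0 0), -σ.value m (K m (d' m))) ∧
        ∀ m < σ.nats 0 0 * σ.nats 0 0, τ.nats 1 m = K m (d m)) := by
  have h₁ := spec_countUp (v := 2) (c := .not (.realLe (.load 2 (.const 1)) (.ofNat (.var 2))))
    (Pre := fun S σ => σ.Fresh ∧ (σ.nats 0 0 * σ.nats 0 0 + 1) * (⌈σ.reals 2 1⌉₊ + 1) ≤ S)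
    (fun σ k => σ.reals 2 1 ≤ k) (fun σ => ⌈σ.reals 2 1⌉₊) (fun S σ h => h.1.nats 2 0 (by simp))
    (fun S σ h => ⟨Nat.le_ceil _, by
      nlinarith [Nat.zero_le (σ.nats 0 0 * σ.nats 0 0 * (⌈σ.reals 2 1⌉₊ + 1))]⟩)
    (fun S σ₀ σ h hs => by simp [Test.Holds, RealExpr.eval, NatExpr.eval, hs.reals 2])
  have h₂ := h₁.seq_of spec_exactFill
    (Post := fun _ σ τ => SameOff {2, 3, 5, 6, 7, 9} {4} σ τ ∧ τ.nats 2 0 = ⌈σ.reals 2 1⌉₊ ∧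
      ∀ i < σ.nats 0 0 * σ.nats 0 0 * (⌈σ.reals 2 1⌉₊ + 1),
          IsCutoff (σ.nats 0 1) (fun k => ¬ ((k + 1 : ℝ) * σ.unitCost (i / (⌈σ.reals 2 1⌉₊ + 1)) ≤
            (i % (⌈σ.reals 2 1⌉₊ + 1) : ℕ))) (τ.nats 9 i) ∧
          τ.reals 4 i = -σ.value (i / (⌈σ.reals 2 1⌉₊ + 1)) (τ.nats 9 i))
    (fun _ _ h => h) (by
      rintro S σ τ ⟨hf, hS⟩ ⟨hs, hT, hmin⟩
      rw [hs.nats 3 (by simp), hs.nats 0 (by simp), le_antisymm (not_lt.1 fun h =>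
        hmin _ h (Nat.le_ceil _)) (Nat.ceil_le.2 hT)]
      refine ⟨hf.nats _ _ (by simp), ?_⟩
      rw [add_mul] at hS
      omega) (by
      rintro S σ τ υ ⟨hf, hS⟩ ⟨hs, hT, hmin⟩ ⟨hs', h⟩
      have h2 : τ.nats 2 0 = ⌈σ.reals 2 1⌉₊ := le_antisymm (not_lt.1 fun h =>
        hmin _ h (Nat.le_ceil _)) (Nat.ceil_le.2 hT)
      refine ⟨hs.trans hs', by rw [hs'.nats 2 (by simp), h2], ?_⟩
      rwa [hs.nats 0 (by simp), h2, hs.unitCost, hs.value] at h)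
  have h₃ := h₂.seq_of spec_solve
    (Post := fun _ σ τ => SameOff {2, 3, 4, 5, 6, 7, 8, 9, 10} {4, 5} σ τ ∧
      τ.nats 2 0 = ⌈σ.reals 2 1⌉₊ ∧ τ.Solved ∧
      ∀ i < σ.nats 0 0 * σ.nats 0 0 * (⌈σ.reals 2 1⌉₊ + 1),
          IsCutoff (σ.nats 0 1) (fun k => ¬ ((k + 1 : ℝ) * σ.unitCost (i / (⌈σ.reals 2 1⌉₊ + 1)) ≤
            (i % (⌈σ.reals 2 1⌉₊ + 1) : ℕ))) (τ.nats 9 i) ∧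
          τ.reals 4 i = -σ.value (i / (⌈σ.reals 2 1⌉₊ + 1)) (τ.nats 9 i))
    (fun _ _ h => h) (by
      rintro S σ τ ⟨hf, hS⟩ ⟨hs, h2, h⟩
      rw [hs.nats 0 (by simp), hs.reals 5 (by simp), h2]
      exact ⟨fun i _ => hf.reals _ _ (by simp), hS⟩) (by
      rintro S σ τ υ ⟨hf, hS⟩ ⟨hs, h2, h⟩ ⟨hs', hsol⟩
      refine ⟨hs.trans hs',
        by rw [hs'.nats 2 (by simp), h2], hsol, ?_⟩
      rwa [hs'.nats 9 (by simp), hs'.reals 4 (by simp)])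
  have hsel := Spec.ofLoopFree (p := .assign 8 (.var 2)) (Pre := fun _ _ => True) trivial
    fun S σ hσ _ => hσ.setNat _ _ (hσ _ _)
  have h₄ := h₃.seq_of hsel
    (Post := fun _ σ τ => SameOff {2, 3, 4, 5, 6, 7, 8, 9, 10} {4, 5} σ τ ∧
      τ.nats 2 0 = ⌈σ.reals 2 1⌉₊ ∧ τ.nats 8 0 = ⌈σ.reals 2 1⌉₊ ∧ τ.Solved ∧
      ∀ i < σ.nats 0 0 * σ.nats 0 0 * (⌈σ.reals 2 1⌉₊ + 1),
          IsCutoff (σ.nats 0 1) (fun k => ¬ ((k + 1 : ℝ) * σ.unitCost (i / (⌈σ.reals 2 1⌉₊ + 1)) ≤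
            (i % (⌈σ.reals 2 1⌉₊ + 1) : ℕ))) (τ.nats 9 i) ∧
          τ.reals 4 i = -σ.value (i / (⌈σ.reals 2 1⌉₊ + 1)) (τ.nats 9 i))
    (fun _ _ h => h) (fun _ _ _ _ _ => trivial) (by
      rintro S σ τ υ - ⟨hs, h2, hsol, h⟩ rfl
      exact ⟨hs.setNat _ _ _, h2, h2, hsol, h⟩)
  refine h₄.seq_of spec_traceback_of_solved (fun _ _ h => h) ?_ ?_
  · rintro S σ τ ⟨hf, hS⟩ ⟨hs, h2, h8, hsol, h⟩
    rw [hs.nats 0 (by simp)]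
    exact ⟨by nlinarith [Nat.zero_le (σ.nats 0 0 * σ.nats 0 0 * ⌈σ.reals 2 1⌉₊)], by omega, hsol⟩
  · rintro S σ τ υ - ⟨hs, h2, h8, hsol, h⟩ ⟨d, h3, h4, h5⟩
    have hopt {d : ℕ → ℕ} {q : ℕ} := hsol.opt_le (d := d) (q := q)
    rw [h8, h2] at h4
    rw [h2] at h5
    rw [h8] at h3
    simp only [h2, hs.nats 0 (show (0 : ℕ) ∉ _ by simp)] at h3 h4 h5 hopt
    have hK (m) (hm : m < σ.nats 0 0 * σ.nats 0 0) (d) (hd : d ≤ ⌈σ.reals 2 1⌉₊) :=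
      h _ (mul_add_lt hm hd)
    have hW {d : ℕ → ℕ} (hd : ∑ m ∈ Finset.range (σ.nats 0 0 * σ.nats 0 0), d m
        ≤ ⌈σ.reals 2 1⌉₊) : ∑ m ∈ Finset.range (σ.nats 0 0 * σ.nats 0 0),
          τ.reals 4 (m * (⌈σ.reals 2 1⌉₊ + 1) + d m) =
        ∑ m ∈ Finset.range (σ.nats 0 0 * σ.nats 0 0),
          -σ.value m (τ.nats 9 (m * (⌈σ.reals 2 1⌉₊ + 1) + d m)) := by
      refine Finset.sum_congr rfl fun m hm => ?_
      have hdm := (Finset.single_le_sum (f := d) (fun _ _ => Nat.zero_le _) hm).trans hd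
      rw [(hK m (Finset.mem_range.1 hm) _ hdm).2, mul_add_div m hdm]
    refine ⟨fun m d => τ.nats 9 (m * (⌈σ.reals 2 1⌉₊ + 1) + d), d, fun m hm d hd => ?_, h3,
      fun d' hd' => ?_, h5⟩
    · have := (hK m hm d hd).1
      rwa [mul_add_div m hd, mul_add_mod m hd] at this
    -- The traced distribution attains the table entry, and the entry is a lower bound for every
    -- competitor.
    · rw [← hW h3, ← hW hd', ← h4]
      exact hopt le_rfl hd'

/-! ## The approximation scheme -/

theorem State.value_nonneg (σ : State) (m k : ℕ) : 0 ≤ σ.value m k := by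
  refine mul_nonneg ?_ (Real.exp_pos _).le
  rw [SyncInstance.offDiag]
  split_ifs <;> norm_num

/-- `k` is the largest rate at which messages of class `m` alone are affordable. -/
abbrev State.IsMaxRate (σ : State) (m k : ℕ) : Prop :=
  IsCutoff (σ.nats 0 1) (fun k => ¬ ((k + 1 : ℝ) * σ.unitCost m ≤ σ.reals 2 1)) k

/-- `L` is the largest value of an affordable policy that uses only a class below `n`. -/
structure State.IsBestSingle (σ : State) (n : ℕ) (L : ℝ) : Prop where
  nonneg : 0 ≤ L
  upper : ∀ m < n, ∃ k, σ.IsMaxRate m k ∧ σ.value m k ≤ L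
  attained : L = 0 ∨ ∃ m < n, ∃ k, σ.IsMaxRate m k ∧ L = σ.value m k

/-- Compute the largest value of an affordable policy that uses only one class. -/
def bestSingle : Program :=
  forEach classesExpr
    (.not (.realLe (.mul (.add (.ofNat (.var 7)) (.ofNat (.const 1))) (unitCostExpr (.var 3)))
      (.load 2 (.const 1))))
    (.cond (.realLe (.load 3 (.const 0)) (valueExpr (.var 3) (.var 5)))
      (.setReal 3 (.const 0) (valueExpr (.var 3) (.var 5))) .skip)

/-- The values increase with the rate, so only the largest affordable rate of each class has to be
inspected. The running maximum starts from the zero in the fresh memory. -/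
theorem spec_bestSingle :
    Spec bestSingle
      (fun S σ => σ.nats 3 0 = 0 ∧ σ.reals 3 0 = 0 ∧ σ.nats 0 0 * σ.nats 0 0 ≤ S)
      (fun _ σ τ => SameOff {3, 5, 6, 7} {3} σ τ ∧
        σ.IsBestSingle (σ.nats 0 0 * σ.nats 0 0) (τ.reals 3 0)) := by
  refine spec_forEach (f := .cond _ (.setReal _ _ _) .skip) ⟨trivial, trivial⟩
    (fun σ m τ => SameOff {3, 5, 6, 7} {3} σ τ ∧ σ.IsBestSingle m (τ.reals 3 0))
    (fun σ m k => ¬ ((k + 1 : ℝ) * σ.unitCost m ≤ σ.reals 2 1))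
    (fun σ => σ.nats 0 0 * σ.nats 0 0) (fun S σ₀ h => h.2.2) ?_ ?_ ?_ ?_ ?_ ?_
  · rintro S σ₀ m σ - ⟨hs, -⟩
    simp [NatExpr.eval, hs.nats 0]
  · rintro S σ₀ m σ - ⟨hs, -⟩
    exact hs.nats 0 (by simp)
  · rintro σ₀ m σ τ ⟨hs, h⟩ hs'
    refine ⟨hs.trans hs', ?_⟩
    rwa [hs'.reals 3 (by simp)]
  · refine fun S σ h => ⟨h.1, .refl _ _ _, ?_⟩
    rw [h.2.1]
    exact ⟨le_rfl, by simp, .inl rfl⟩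
  · rintro S σ₀ m σ - ⟨hs, -⟩ - rfl
    simp only [Test.Holds, RealExpr.eval, eval_unitCostExpr, hs.unitCost]
    simp only [NatExpr.eval, hs.reals 2 (show (2 : ℕ) ∉ _ by simp), Nat.cast_one]
  · rintro S σ₀ m σ - ⟨hs, h⟩ - rfl hσ hcut
    by_cases hc : Test.Holds σ (.realLe (.load 3 (.const 0)) (valueExpr (.var 3) (.var 5)))
    · have hc' : σ.reals 3 0 ≤ σ₀.value (σ.nats 3 0) (σ.nats 5 0) := by
        simpa only [Test.Holds, RealExpr.eval, eval_valueExpr, NatExpr.eval, hs.value] using hc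
      rw [Program.exec_cond_of_holds hc, Program.exec_setReal, eval_valueExpr, hs.value]
      refine ⟨hσ, ⟨hs.setReal _ _ _, ?_⟩, rfl⟩
      simp only [NatExpr.eval, State.reals_setReal, if_true, Function.update_self]
      refine ⟨h.nonneg.trans hc', fun m hm => ?_, .inr ⟨_, Nat.lt_succ_self _, _, hcut, rfl⟩⟩
      rcases (Nat.lt_succ_iff.1 hm).eq_or_lt with rfl | hm
      · exact ⟨_, hcut, le_rfl⟩
      · obtain ⟨k, hk, hkL⟩ := h.upper m hm
        exact ⟨k, hk, hkL.trans hc'⟩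
    · have hc' : σ₀.value (σ.nats 3 0) (σ.nats 5 0) < σ.reals 3 0 := by
        simpa only [Test.Holds, RealExpr.eval, eval_valueExpr, NatExpr.eval, hs.value,
          not_le] using hc
      rw [Program.exec_cond_of_not_holds hc, Program.exec_skip]
      refine ⟨hσ, ⟨hs, h.nonneg, fun m hm => ?_, ?_⟩, rfl⟩
      · rcases (Nat.lt_succ_iff.1 hm).eq_or_lt with rfl | hm
        · exact ⟨_, hcut, hc'.le⟩
        · exact h.upper m hm
      · exact h.attained.imp_right fun ⟨m, hm, h'⟩ => ⟨m, hm.trans (Nat.lt_succ_self _), h'⟩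

/-- The value of class `m` at rate `k` is at least `L`, up to `d` units of size `L / Q`. -/
def State.Reaches (σ : State) (L : ℝ) (Q m d k : ℕ) : Prop := L ≤ σ.value m k + d * (L / Q)

open Classical in
/-- The cost of class `m` at rate `k`, made unaffordable if the value is too small. -/
noncomputable def State.weight (σ : State) (L : ℝ) (Q m d k : ℕ) : ℝ :=
  if σ.Reaches L Q m d k then k * σ.unitCost m else σ.reals 2 1 + 1

theorem State.weight_of_reaches {σ : State} {L : ℝ} {Q m d k : ℕ} (h : σ.Reaches L Q m d k) :
    σ.weight L Q m d k = k * σ.unitCost m := if_pos h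

theorem State.weight_of_not_reaches {σ : State} {L : ℝ} {Q m d k : ℕ}
    (h : ¬ σ.Reaches L Q m d k) : σ.weight L Q m d k = σ.reals 2 1 + 1 := if_neg h

/-- The test whether rate `k` suffices for the table index in variable `3`. -/
def reachesTest (k : NatExpr) : Test :=
  .realLe (.load 3 (.const 0)) (.add (valueExpr rowExpr k)
    (.mul (.ofNat colExpr) (.div (.load 3 (.const 0)) (.ofNat (.var 11)))))

theorem holds_reachesTest (σ : State) (k : NatExpr) :
    (reachesTest k).Holds σ ↔ σ.Reaches (σ.reals 3 0) (σ.nats 11 0)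
      (σ.nats 3 0 / (σ.nats 2 0 + 1)) (σ.nats 3 0 % (σ.nats 2 0 + 1)) (k.eval σ) := by
  simp only [reachesTest, Test.Holds, RealExpr.eval, eval_valueExpr, NatExpr.eval_mod,
    State.Reaches]
  simp only [NatExpr.eval]

/-- The tables of the approximation scheme: `K` is the least sufficient rate. -/
def approxFill : Program :=
  fill (reachesTest (.var 7)) (.cond (reachesTest (.var 5))
    (.setReal 4 (.var 3) (.mul (.ofNat (.var 5)) (unitCostExpr rowExpr)))
    (.setReal 4 (.var 3) (.add (.load 2 (.const 1)) (.ofNat (.const 1)))))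

theorem SameOff.reaches {A B : Set ℕ} {σ τ : State} (h : SameOff A B σ τ)
    (hA : 0 ∉ A := by simp) (hB : 0 ∉ B := by simp) (hB' : 2 ∉ B := by simp) :
    τ.Reaches = σ.Reaches := by
  funext L Q m d k
  rw [State.Reaches, State.Reaches, h.value hA hB hB']

theorem SameOff.weight {A B : Set ℕ} {σ τ : State} (h : SameOff A B σ τ)
    (hA : 0 ∉ A := by simp) (hB : 0 ∉ B := by simp) (hB₁ : 1 ∉ B := by simp)
    (hB₂ : 2 ∉ B := by simp) : τ.weight = σ.weight := by
  funext L Q m d k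
  have hr : τ.Reaches L Q m d k ↔ σ.Reaches L Q m d k := by rw [h.reaches hA hB hB₂]
  by_cases h' : σ.Reaches L Q m d k
  · rw [State.weight_of_reaches h', State.weight_of_reaches (hr.2 h'), h.unitCost hA hB₁]
  · rw [State.weight_of_not_reaches h', State.weight_of_not_reaches (mt hr.1 h'), h.reals 2 hB₂]

/-- After the search the test is evaluated once more at the rate found, because a search that ends
at `R` has never tested `R`; if it fails there, the entry is made unaffordable. -/
theorem spec_approxFill :
    Spec approxFill
      (fun S σ => σ.nats 3 0 = 0 ∧ σ.nats 0 0 * σ.nats 0 0 * (σ.nats 2 0 + 1) ≤ S)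
      (fun _ σ τ => SameOff {3, 5, 6, 7, 9} {4} σ τ ∧
        ∀ i < σ.nats 0 0 * σ.nats 0 0 * (σ.nats 2 0 + 1),
          IsCutoff (σ.nats 0 1) (σ.Reaches (σ.reals 3 0) (σ.nats 11 0) (i / (σ.nats 2 0 + 1))
            (i % (σ.nats 2 0 + 1))) (τ.nats 9 i) ∧
          τ.reals 4 i = σ.weight (σ.reals 3 0) (σ.nats 11 0) (i / (σ.nats 2 0 + 1))
            (i % (σ.nats 2 0 + 1)) (τ.nats 9 i)) := by
  refine spec_fill (show Program.LoopFree (.cond _ (.setReal _ _ _) (.setReal _ _ _)) from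
    ⟨trivial, trivial⟩) (fun σ i => σ.Reaches (σ.reals 3 0) (σ.nats 11 0) (i / (σ.nats 2 0 + 1))
      (i % (σ.nats 2 0 + 1))) (fun σ i => σ.weight (σ.reals 3 0) (σ.nats 11 0)
        (i / (σ.nats 2 0 + 1)) (i % (σ.nats 2 0 + 1))) ?_ ?_
  · intro σ₀ σ hs
    rw [holds_reachesTest, hs.reaches, hs.reals 3 (by simp), hs.nats 11 (by simp),
      hs.nats 2 (by simp)]
    rfl
  · intro σ₀ σ hs
    have h : _ ↔ σ.Reaches _ _ _ _ (σ.nats 5 0) := holds_reachesTest σ (.var 5)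
    rw [← hs.weight, ← hs.reals 3 (by simp), ← hs.nats 11 (by simp), ← hs.nats 2 (by simp)]
    by_cases hc : (reachesTest (.var 5)).Holds σ
    · rw [Program.exec_cond_of_holds hc, State.weight_of_reaches (h.1 hc), Program.exec_setReal]
      simp only [RealExpr.eval, eval_unitCostExpr]
      rfl
    · rw [Program.exec_cond_of_not_holds hc,
        State.weight_of_not_reaches (mt h.2 hc), Program.exec_setReal]
      simp only [RealExpr.eval, NatExpr.eval, Nat.cast_one]

/-- Find the first entry of the last row of the table `D` that is within the budget. -/
def selectLeast : Program :=
  .seq (.assign 8 (.const 0))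
    (.loop (.not (.realLe (.load 5 (.add (.mul classesExpr widthExpr) (.var 8)))
      (.load 2 (.const 1)))) (.assign 8 (.add (.var 8) (.const 1))))

theorem spec_selectLeast :
    Spec selectLeast
      (fun S σ => σ.nats 2 0 ≤ S ∧ σ.opt (σ.nats 2 0) ≤ σ.reals 2 1)
      (fun _ σ τ => SameOff {8} ∅ σ τ ∧ σ.opt (τ.nats 8 0) ≤ σ.reals 2 1 ∧
        ∀ j < τ.nats 8 0, ¬ σ.opt j ≤ σ.reals 2 1) := by
  have h₁ := Spec.ofLoopFree (p := .assign 8 (.const 0)) (Pre := fun _ _ => True) trivial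
    fun S σ hσ _ => hσ.setNat _ _ (by simp [NatExpr.eval])
  have h₂ := spec_countUp (v := 8)
    (c := .not (.realLe (.load 5 (.add (.mul classesExpr widthExpr) (.var 8)))
      (.load 2 (.const 1))))
    (Pre := fun S σ => σ.nats 8 0 = 0 ∧ σ.nats 2 0 ≤ S ∧ σ.opt (σ.nats 2 0) ≤ σ.reals 2 1)
    (fun σ q => σ.opt q ≤ σ.reals 2 1) (fun σ => σ.nats 2 0) (fun S σ h => h.1)
    (fun S σ h => ⟨h.2.2, h.2.1⟩)
    (fun S σ₀ σ h hs => by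
      simp [Test.Holds, RealExpr.eval, NatExpr.eval, hs.reals 2, hs.reals 5, hs.nats 0, hs.nats 2,
        State.opt])
  refine h₁.seq_of h₂ (fun _ _ _ => trivial) ?_ ?_
  · rintro S σ τ ⟨h3, h4⟩ rfl
    exact ⟨rfl, h3, h4⟩
  · rintro S σ τ υ - rfl ⟨hs, h5⟩
    exact ⟨((SameOff.refl {8} ∅ σ).setNat 8 0 0).trans hs, h5⟩

/-- The number of units into which the value of the best single item is divided. -/
noncomputable def State.units (σ : State) : ℕ :=
  ⌈((σ.nats 0 0 * σ.nats 0 0 : ℕ) : ℝ) / σ.reals 2 2⌉₊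

/-- The memory `τ` holds the tables of the approximation scheme for the input in `σ`. -/
structure State.ApproxTables (σ τ : State) (L : ℝ) : Prop where
  best : σ.IsBestSingle (σ.nats 0 0 * σ.nats 0 0) L
  width : τ.nats 2 0 = σ.nats 0 0 * σ.nats 0 0 * σ.units
  cutoff : ∀ m < σ.nats 0 0 * σ.nats 0 0, ∀ d ≤ σ.nats 0 0 * σ.nats 0 0 * σ.units,
    IsCutoff (σ.nats 0 1) (σ.Reaches L σ.units m d)
      (τ.nats 9 (m * (σ.nats 0 0 * σ.nats 0 0 * σ.units + 1) + d))
  weight : ∀ m < σ.nats 0 0 * σ.nats 0 0, ∀ d ≤ σ.nats 0 0 * σ.nats 0 0 * σ.units,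
    τ.reals 4 (m * (σ.nats 0 0 * σ.nats 0 0 * σ.units + 1) + d) = σ.weight L σ.units m d
      (τ.nats 9 (m * (σ.nats 0 0 * σ.nats 0 0 * σ.units + 1) + d))

theorem State.ApproxTables.congr {σ τ τ' : State} {L : ℝ} (h : σ.ApproxTables τ L)
    (h₂ : τ'.nats 2 = τ.nats 2) (h₉ : τ'.nats 9 = τ.nats 9) (h₄ : τ'.reals 4 = τ.reals 4) :
    σ.ApproxTables τ' L where
  best := h.best
  width := by rw [h₂, h.width]
  cutoff := by rw [h₉]; exact h.cutoff
  weight := by rw [h₉, h₄]; exact h.weight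

theorem State.units_pos {σ : State} (hε : 0 < σ.reals 2 2)
    (hn : 0 < σ.nats 0 0 * σ.nats 0 0) : 0 < σ.units :=
  Nat.ceil_pos.2 (div_pos (by exact_mod_cast hn) hε)

/-- The smallest rates are sufficient if every class may miss all units. -/
theorem State.ApproxTables.weight_units {σ τ : State} {L : ℝ} (h : σ.ApproxTables τ L)
    (hε : 0 < σ.reals 2 2) {m : ℕ} (hm : m < σ.nats 0 0 * σ.nats 0 0) :
    τ.reals 4 (m * (σ.nats 0 0 * σ.nats 0 0 * σ.units + 1) + σ.units) = 0 := by
  have hle : σ.units ≤ σ.nats 0 0 * σ.nats 0 0 * σ.units := Nat.le_mul_of_pos_left _ (by omega)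
  have hr (k : ℕ) : σ.Reaches L σ.units m σ.units k := by
    have hu : (σ.units : ℝ) ≠ 0 := by
      have := σ.units_pos hε (by omega)
      positivity
    rw [State.Reaches, mul_div_cancel₀ _ hu]
    linarith [σ.value_nonneg m k]
  have h0 : τ.nats 9 (m * (σ.nats 0 0 * σ.nats 0 0 * σ.units + 1) + σ.units) = 0 := by
    by_contra h0
    exact (h.cutoff m hm _ hle).pred (Nat.pos_of_ne_zero h0) (hr _)
  rw [h.weight m hm _ hle, State.weight_of_reaches (hr _), h0, Nat.cast_zero, zero_mul]

/-- Giving all `Q` units to each of the `n` classes costs nothing and uses exactly the `n * Q` units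
of the last column. This guarantees that the search for an affordable column succeeds. -/
theorem State.ApproxTables.opt_le {σ τ : State} {L : ℝ} (h : σ.ApproxTables τ L)
    (hsol : τ.Solved) (h₀ : τ.nats 0 = σ.nats 0) (hε : 0 < σ.reals 2 2) :
    τ.opt (τ.nats 2 0) ≤ 0 := by
  refine (hsol.opt_le (d := fun _ => σ.units) le_rfl ?_).trans_eq ?_
  · simp [h.width, h₀]
  · rw [h₀, h.width]
    exact Finset.sum_eq_zero fun m hm => h.weight_units hε (Finset.mem_range.1 hm)

/-- The approximation scheme. -/
def approxProgram : Program :=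
  .seq (.seq (.seq (.seq (.seq (.seq bestSingle
    (.loop (.not (.realLe (.ofNat classesExpr) (.mul (.load 2 (.const 2)) (.ofNat (.var 11)))))
      (.assign 11 (.add (.var 11) (.const 1)))))
    (.seq (.assign 3 (.const 0)) (.assign 2 (.mul classesExpr (.var 11))))) approxFill) solve)
    selectLeast) traceback

theorem spec_approxProgram :
    Spec approxProgram
      (fun S σ => σ.Fresh ∧ 0 < σ.reals 2 2 ∧ 0 ≤ σ.reals 2 1 ∧
        (σ.nats 0 0 * σ.nats 0 0 + 1) * (σ.nats 0 0 * σ.nats 0 0 * σ.units + 1) + σ.units ≤ S)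
      (fun _ σ τ => ∃ (L : ℝ) (K : ℕ → ℕ → ℕ) (q : ℕ) (d : ℕ → ℕ),
        σ.IsBestSingle (σ.nats 0 0 * σ.nats 0 0) L ∧
        (∀ m < σ.nats 0 0 * σ.nats 0 0, ∀ d ≤ σ.nats 0 0 * σ.nats 0 0 * σ.units,
          IsCutoff (σ.nats 0 1) (σ.Reaches L σ.units m d) (K m d)) ∧
        q ≤ σ.nats 0 0 * σ.nats 0 0 * σ.units ∧
        ∑ m ∈ Finset.range (σ.nats 0 0 * σ.nats 0 0), d m ≤ q ∧
        ∑ m ∈ Finset.range (σ.nats 0 0 * σ.nats 0 0), σ.weight L σ.units m (d m) (K m (d m))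
          ≤ σ.reals 2 1 ∧
        (∀ d' : ℕ → ℕ, ∑ m ∈ Finset.range (σ.nats 0 0 * σ.nats 0 0), d' m
            ≤ σ.nats 0 0 * σ.nats 0 0 * σ.units →
          ∑ m ∈ Finset.range (σ.nats 0 0 * σ.nats 0 0),
            σ.weight L σ.units m (d' m) (K m (d' m)) ≤ σ.reals 2 1 →
          q ≤ ∑ m ∈ Finset.range (σ.nats 0 0 * σ.nats 0 0), d' m) ∧
        ∀ m < σ.nats 0 0 * σ.nats 0 0, τ.nats 1 m = K m (d m)) := by
  have hcount := spec_countUp (v := 11)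
    (c := .not (.realLe (.ofNat classesExpr) (.mul (.load 2 (.const 2)) (.ofNat (.var 11)))))
    (Pre := fun S σ => σ.nats 11 0 = 0 ∧ 0 < σ.reals 2 2 ∧ σ.units ≤ S)
    (fun σ k => σ.units ≤ k) (fun σ => σ.units) (fun S σ h => h.1)
    (fun S σ h => ⟨le_rfl, h.2.2⟩)
    (fun S σ₀ σ h hs => by
      -- The ceiling of `n / ε` is reached as soon as `n ≤ ε * k`, which is a comparison of reals.
      rw [State.units, Nat.ceil_le, div_le_iff₀ h.2.1]
      simp [Test.Holds, RealExpr.eval, NatExpr.eval, hs.reals 2, hs.nats 0,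
        mul_comm (σ₀.reals 2 2)])
  have hprep := Spec.ofLoopFree
    (p := .seq (.assign 3 (.const 0)) (.assign 2 (.mul classesExpr (.var 11))))
    (Pre := fun S σ => σ.nats 0 0 * σ.nats 0 0 * σ.nats 11 0 ≤ S) ⟨trivial, trivial⟩
    fun S σ hσ h => (hσ.setNat _ _ (by simp [NatExpr.eval])).setNat _ _
      ((size_le_self _).trans (by simpa [NatExpr.eval, Program.exec] using h))
  have hunits {A B : Set ℕ} {σ τ : State} (h : SameOff A B σ τ) (hA : 0 ∉ A) (hB : 2 ∉ B) :
      τ.units = σ.units := by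
    rw [State.units, State.units, h.nats 0 hA, h.reals 2 hB]
  have h₁ := spec_bestSingle.seq_of hcount
    (Pre := fun S σ => σ.Fresh ∧ 0 < σ.reals 2 2 ∧ 0 ≤ σ.reals 2 1 ∧
      (σ.nats 0 0 * σ.nats 0 0 + 1) * (σ.nats 0 0 * σ.nats 0 0 * σ.units + 1) + σ.units ≤ S)
    (Post := fun _ σ τ => SameOff {3, 5, 6, 7, 11} {3} σ τ ∧ τ.nats 11 0 = σ.units ∧
      σ.IsBestSingle (σ.nats 0 0 * σ.nats 0 0) (τ.reals 3 0))
    (by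
      rintro S σ ⟨hf, -, -, hS⟩
      have := Nat.le_mul_of_pos_right (σ.nats 0 0 * σ.nats 0 0 + 1)
        (Nat.add_one_pos (σ.nats 0 0 * σ.nats 0 0 * σ.units))
      exact ⟨hf.nats _ _ (by simp), hf.reals _ _ (by simp), by omega⟩)
    (by
      rintro S σ τ ⟨hf, hε, -, hS⟩ ⟨hs, -⟩
      rw [hunits hs (by simp) (by simp), hs.nats 11 (by simp), hs.reals 2 (by simp)]
      exact ⟨hf.nats _ _ (by simp), hε, by omega⟩)
    (by
      rintro S σ τ υ - ⟨hs, hL⟩ ⟨hs', h1, h2⟩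
      rw [hunits hs (by simp) (by simp)] at h1 h2
      rw [hs'.reals 3 (by simp)]
      exact ⟨hs.trans hs', le_antisymm (not_lt.1 fun h => h2 _ h le_rfl) h1, hL⟩)
  have h₂ := h₁.seq_of hprep
    (Post := fun _ σ τ => SameOff {2, 3, 5, 6, 7, 11} {3} σ τ ∧ τ.nats 11 0 = σ.units ∧
      τ.nats 3 0 = 0 ∧ τ.nats 2 0 = σ.nats 0 0 * σ.nats 0 0 * σ.units ∧
      σ.IsBestSingle (σ.nats 0 0 * σ.nats 0 0) (τ.reals 3 0))
    (fun _ _ h => h)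
    (by
      rintro S σ τ ⟨hf, hε, -, hS⟩ ⟨hs, h11, -⟩
      rw [h11, hs.nats 0 (by simp)]
      rw [add_mul] at hS
      omega)
    (by
      rintro S σ τ υ - ⟨hs, h11, hL⟩ rfl
      refine ⟨(hs.mono.setNat _ _ _).setNat _ _ _, ?_, ?_, ?_, hL⟩
      · simpa [Program.exec] using h11
      · simp [Program.exec, NatExpr.eval]
      · simp [Program.exec, NatExpr.eval, h11, hs.nats 0])
  have h₃ := h₂.seq_of spec_approxFill
    (Post := fun _ σ τ => SameOff {2, 3, 5, 6, 7, 9, 11} {3, 4} σ τ ∧ ∃ L, σ.ApproxTables τ L)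
    (fun _ _ h => h)
    (by
      rintro S σ τ ⟨hf, hε, -, hS⟩ ⟨hs, h11, h3, h2, -⟩
      rw [h2, hs.nats 0 (by simp)]
      rw [add_mul] at hS
      exact ⟨h3, by omega⟩)
    (by
      rintro S σ τ υ - ⟨hs, h11, h3, h2, hL⟩ ⟨hs', h⟩
      refine ⟨hs.trans hs', τ.reals 3 0, hL, by rw [hs'.nats 2 (by simp), h2],
        fun m hm d hd => ?_, fun m hm d hd => ?_⟩
      all_goals
        rw [h2, h11, hs.nats 0 (by simp), hs.reaches, hs.weight] at h
        have := h _ (mul_add_lt hm hd)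
        rw [mul_add_div m hd, mul_add_mod m hd] at this
      · exact this.1
      · exact this.2)
  have h₄ := h₃.seq_of spec_solve
    (Post := fun _ σ τ => SameOff {2, 3, 4, 5, 6, 7, 8, 9, 10, 11} {3, 4, 5} σ τ ∧ τ.Solved ∧
      ∃ L, σ.ApproxTables τ L)
    (fun _ _ h => h)
    (by
      rintro S σ τ ⟨hf, hε, -, hS⟩ ⟨hs, L, hT⟩
      rw [hs.nats 0 (by simp), hs.reals 5 (by simp), hT.width]
      exact ⟨fun i _ => hf.reals _ _ (by simp), by omega⟩)
    (by
      rintro S σ τ υ - ⟨hs, L, hT⟩ ⟨hs', hsol⟩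
      exact ⟨hs.trans hs', hsol, L, hT.congr (hs'.nats 2 (by simp)) (hs'.nats 9 (by simp))
        (hs'.reals 4 (by simp))⟩)
  have h₅ := h₄.seq_of spec_selectLeast
    (Post := fun _ σ τ => SameOff {2, 3, 4, 5, 6, 7, 8, 9, 10, 11} {3, 4, 5} σ τ ∧ τ.Solved ∧
      (∃ L, σ.ApproxTables τ L) ∧ τ.nats 8 0 ≤ τ.nats 2 0 ∧ τ.opt (τ.nats 8 0) ≤ σ.reals 2 1 ∧
      ∀ j < τ.nats 8 0, ¬ τ.opt j ≤ σ.reals 2 1)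
    (fun _ _ h => h)
    (by
      rintro S σ τ ⟨hf, hε, hB, hS⟩ ⟨hs, hsol, L, hT⟩
      rw [hs.reals 2 (by simp)]
      refine ⟨?_, (hT.opt_le hsol (hs.nats 0 (by simp)) hε).trans hB⟩
      rw [hT.width]
      rw [add_mul] at hS
      omega)
    (by
      rintro S σ τ υ ⟨hf, hε, hB, hS⟩ ⟨hs, hsol, L, hT⟩ ⟨hs', hq, hmin⟩
      have e0 := hs'.nats 0 (by simp)
      have e2 := hs'.nats 2 (by simp)
      have e5 := hs'.reals 5 (by simp)
      have hopt : υ.opt = τ.opt := by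
        funext q
        rw [State.opt, State.opt, e0, e2, e5]
      rw [hopt, ← hs.reals 2 (by simp)]
      refine ⟨hs.trans hs', ?_, ⟨L, hT.congr e2 (hs'.nats 9 (by simp)) (hs'.reals 4 (by simp))⟩,
        ?_, hq, hmin⟩
      · rw [State.Solved, e0, e2, e5, hs'.reals 4 (by simp), hs'.nats 10 (by simp)]
        exact hsol
      · rw [e2]
        refine not_lt.1 fun hlt => hmin _ hlt ?_
        rw [hs.reals 2 (by simp)]
        exact (hT.opt_le hsol (hs.nats 0 (by simp)) hε).trans hB)
  refine h₅.seq_of spec_traceback_of_solved (fun _ _ h => h) ?_ ?_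
  · rintro S σ τ ⟨hf, hε, -, hS⟩ ⟨hs, hsol, -, h8, -⟩
    rw [hs.nats 0 (by simp)]
    have := Nat.le_mul_of_pos_right (σ.nats 0 0 * σ.nats 0 0 + 1)
      (Nat.add_one_pos (σ.nats 0 0 * σ.nats 0 0 * σ.units))
    exact ⟨by omega, h8, hsol⟩
  · rintro S σ τ υ - ⟨hs, hsol, ⟨L, hT⟩, h8, hB, hmin⟩ ⟨d, h3, h4, h5⟩
    have hopt {d : ℕ → ℕ} {q : ℕ} := hsol.opt_le (d := d) (q := q)
    rw [h4] at hB
    simp only [hT.width, hs.nats 0 (show (0 : ℕ) ∉ _ by simp)] at h3 h5 h8 hopt hB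
    have hW {d : ℕ → ℕ} (hd : ∑ m ∈ Finset.range (σ.nats 0 0 * σ.nats 0 0), d m
        ≤ σ.nats 0 0 * σ.nats 0 0 * σ.units) : ∑ m ∈ Finset.range (σ.nats 0 0 * σ.nats 0 0),
          τ.reals 4 (m * (σ.nats 0 0 * σ.nats 0 0 * σ.units + 1) + d m) =
        ∑ m ∈ Finset.range (σ.nats 0 0 * σ.nats 0 0), σ.weight L σ.units m (d m)
          (τ.nats 9 (m * (σ.nats 0 0 * σ.nats 0 0 * σ.units + 1) + d m)) :=
      Finset.sum_congr rfl fun m hm => hT.weight m (Finset.mem_range.1 hm) _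
        ((Finset.single_le_sum (f := d) (fun _ _ => Nat.zero_le _) hm).trans hd)
    refine ⟨L, fun m d => τ.nats 9 (m * (σ.nats 0 0 * σ.nats 0 0 * σ.units + 1) + d),
      τ.nats 8 0, d, hT.best, hT.cutoff, h8, h3, ?_, fun d' hd' hB' => ?_, h5⟩
    · rwa [← hW (h3.trans h8)]
    · by_contra! hlt
      rw [← hW hd'] at hB'
      -- A distribution with fewer than `q` units would make the column given by its sum affordable,
      -- before the first affordable one.
      exact hmin _ hlt ((hopt hd' le_rfl).trans hB')

theorem State.IsBestSingle.value_le {σ : State} {n : ℕ} {L : ℝ} (h : σ.IsBestSingle n L)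
    (ha : ∀ m, 0 ≤ σ.unitCost m) (hv : ∀ m, Monotone (σ.value m)) {m : ℕ} (hm : m < n) {k : ℕ}
    (hk : k ≤ σ.nats 0 1) (hkB : (k : ℝ) * σ.unitCost m ≤ σ.reals 2 1) : σ.value m k ≤ L := by
  obtain ⟨l, hl, hlL⟩ := h.upper m hm
  refine (hv m ?_).trans hlL
  by_contra! hlt
  refine hl.self (hlt.trans_le hk) (le_trans ?_ hkB)
  exact mul_le_mul_of_nonneg_right (by exact_mod_cast hlt) (ha m)

/-- This is what makes `L` a lower bound for the optimum: the best class is used alone at its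
maximal rate, and the other classes at rate zero contribute nonnegative values. -/
theorem State.IsBestSingle.exists_rates {σ : State} {n : ℕ} {L : ℝ} (h : σ.IsBestSingle n L)
    (hB : 0 ≤ σ.reals 2 1) : ∃ x : ℕ → ℕ, (∀ m < n, x m ≤ σ.nats 0 1) ∧
      ∑ m ∈ Finset.range n, (x m : ℝ) * σ.unitCost m ≤ σ.reals 2 1 ∧
      L ≤ ∑ m ∈ Finset.range n, σ.value m (x m) := by
  rcases h.attained with rfl | ⟨m, hm, k, hk, rfl⟩
  · exact ⟨0, by simp, by simpa using hB, Finset.sum_nonneg fun m _ => σ.value_nonneg m _⟩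
  · refine ⟨fun i => if i = m then k else 0, fun i _ => ?_, ?_, ?_⟩
    · dsimp only
      split_ifs
      · exact hk.le
      · exact Nat.zero_le _
    · dsimp only
      rw [Finset.sum_eq_single_of_mem m (Finset.mem_range.2 hm) (by simp +contextual), if_pos rfl]
      rcases Nat.eq_zero_or_pos k with rfl | hpos
      · simpa using hB
      · have := not_not.1 (hk.pred hpos)
        rwa [Nat.cast_sub (show 1 ≤ k from hpos), Nat.cast_one, sub_add_cancel] at this
    · refine le_trans (by simp) (Finset.single_le_sum
        (f := fun i => σ.value i (if i = m then k else 0)) (fun i _ => σ.value_nonneg i _)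
        (Finset.mem_range.2 hm))

end RealRAM

namespace SyncInstance

open RealRAM

theorem fresh_inputState (I : SyncInstance) (ε : ℝ) : (I.inputState ε).Fresh where
  nats a k ha := by
    simp only [inputState]
    split <;> simp_all
  reals a k ha := by
    simp only [inputState]
    split <;> simp_all

end SyncInstance

/-! ### Time bounds and guarantees of the two programs -/

open RealRAM SyncInstance

theorem isPseudopolynomialExactAlgorithm_exactProgram :
    IsPseudopolynomialExactAlgorithm exactProgram := by
  obtain ⟨f, hf⟩ := spec_exactProgram
  -- The product bounds the size of the table, as `C * C` and `B` are at most the argument; the two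
  -- further summands bound the binary lengths of `C` and `R`.
  refine ⟨f.comp ((.X + 1) * (.X + 1) + .X + .X), fun I hI => ?_⟩
  obtain ⟨N, hN⟩ := hI.2
  have hceil : ⌈(I.inputState 0).reals 2 1⌉₊ = N := by
    change ⌈I.B⌉₊ = N
    rw [hN, Nat.ceil_natCast]
  have hfloor : ⌊I.B⌋₊ = N := by rw [hN, Nat.floor_natCast]
  have hsize := I.inputSize.le_refl
  conv_lhs at hsize => rw [inputSize]
  set x := I.inputSize + I.R + ⌊I.B⌋₊ with hx
  have hS : (I.C * I.C + 1) * (N + 1) + Nat.size I.C + Nat.size I.R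
      ≤ (x + 1) * (x + 1) + x + x := by
    have : (I.C * I.C + 1) * (N + 1) ≤ (x + 1) * (x + 1) :=
      Nat.mul_le_mul (by omega) (by omega)
    omega
  obtain ⟨τ, t, h1, h2, -, K, d, hK, hd, hmin, hout⟩ := hf ((x + 1) * (x + 1) + x + x)
    (I.inputState 0)
    (I.bdd_inputState 0 (by omega) (by omega)) ⟨I.fresh_inputState 0, by
      rw [hceil]
      change (I.C * I.C + 1) * (N + 1) ≤ _
      omega⟩
  refine ⟨τ, t, h1, by simpa using h2, ?_⟩
  rw [hceil] at hK hd hmin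
  obtain ⟨h3, h4⟩ := Knapsack.exact_optimal (I.unitCost_nonneg 0) (I.value_monotone 0)
    (I.exists_unitCost_eq 0 hI) hK hd hmin
  have hdN (m) (hm : m < I.C * I.C) : d m ≤ N :=
    (Finset.single_le_sum (f := d) (fun _ _ => Nat.zero_le _) (Finset.mem_range.2 hm)).trans hd
  constructor
  · refine I.feasible_outputPolicy 0 (fun m hm => ?_) ?_
    · rw [hout m hm]
      exact (hK m hm _ (hdN m hm)).le
    · rw [hN]
      refine le_of_eq_of_le (Finset.sum_congr rfl fun m hm => ?_) h3
      rw [hout m (Finset.mem_range.1 hm)]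
  · intro y hy
    obtain ⟨x, hx1, hx2, hx3⟩ := I.exists_rates 0 hy
    rw [← hx3, I.consistencyLevel_outputPolicy 0]
    refine (h4 x hx1 (hN ▸ hx2)).trans_eq (Finset.sum_congr rfl fun m hm => ?_)
    rw [hout m (Finset.mem_range.1 hm)]

theorem isFPTAS_approxProgram : IsFPTAS approxProgram := by
  obtain ⟨f, hf⟩ := spec_approxProgram
  -- Here `n ≤ x` and `Q ≤ x * x`, so the width `n * Q + 1` of the table is at most `x * (x * x) +
  -- 1`.
  refine ⟨f.comp ((.X + 1) * (.X * (.X * .X) + 1) + .X * .X + .X + .X), fun I ε hε hε1 => ?_⟩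
  have hunits : (I.inputState ε).units = ⌈((I.C * I.C : ℕ) : ℝ) / ε⌉₊ := rfl
  set Q := (I.inputState ε).units with hQ
  have hsize := I.inputSize.le_refl
  conv_lhs at hsize => rw [inputSize]
  set x := I.inputSize + ⌈1 / ε⌉₊ with hx
  have hQle : Q ≤ x * x := by
    refine le_trans ?_ (Nat.mul_le_mul (show I.C * I.C ≤ x by omega)
      (show ⌈1 / ε⌉₊ ≤ x by omega))
    rw [hunits, Nat.ceil_le, Nat.cast_mul _ ⌈1 / ε⌉₊, div_eq_mul_one_div]
    exact mul_le_mul_of_nonneg_left (Nat.le_ceil _) (Nat.cast_nonneg _)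
  have hS : (I.C * I.C + 1) * (I.C * I.C * Q + 1) + Q + Nat.size I.C + Nat.size I.R
      ≤ (x + 1) * (x * (x * x) + 1) + x * x + x + x := by
    have : (I.C * I.C + 1) * (I.C * I.C * Q + 1) ≤ (x + 1) * (x * (x * x) + 1) :=
      Nat.mul_le_mul (by omega) (Nat.add_le_add_right (Nat.mul_le_mul (by omega) hQle) 1)
    omega
  obtain ⟨τ, t, h1, h2, -, L, K, q, d, hL, hK, hq, hd, hdB, hmin, hout⟩ := hf
    ((x + 1) * (x * (x * x) + 1) + x * x + x + x) (I.inputState ε)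
    (I.bdd_inputState ε (by omega) (by omega)) ⟨I.fresh_inputState ε, hε, I.B_pos.le, by
      change (I.C * I.C + 1) * (I.C * I.C * Q + 1) + Q ≤ _
      omega⟩
  refine ⟨τ, t, h1, by simpa using h2, ?_⟩
  obtain ⟨h3, h4⟩ := Knapsack.approx_optimal (R := I.R) (I.unitCost_nonneg ε)
    (I.value_monotone ε) ((I.inputState ε).value_nonneg) (State.units_pos hε) hL.nonneg rfl
    (fun m hm k => hL.value_le (I.unitCost_nonneg ε) (I.value_monotone ε) hm) hK
    (W := fun m d => (I.inputState ε).weight L Q m d (K m d))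
    (fun m hm d hd h => State.weight_of_reaches h)
    (fun m hm d hd h => State.weight_of_not_reaches h) I.B_pos.le hq hd hdB hmin
  have hdN (m) (hm : m < I.C * I.C) : d m ≤ I.C * I.C * Q :=
    ((Finset.single_le_sum (f := d) (fun _ _ => Nat.zero_le _)
      (Finset.mem_range.2 hm)).trans hd).trans hq
  constructor
  · refine I.feasible_outputPolicy ε (fun m hm => ?_) ?_
    · rw [hout m hm]
      exact (hK m hm _ (hdN m hm)).le
    · refine le_of_eq_of_le (Finset.sum_congr rfl fun m hm => ?_) h3
      rw [hout m (Finset.mem_range.1 hm)]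
  · have hloss : ((I.C * I.C : ℕ) : ℝ) * (L / Q) ≤ ε * L := by
      -- For `Q = 0` the quotient `L / Q` is zero by convention; otherwise `n ≤ ε * Q` by the choice
      -- of `Q`.
      rcases Nat.eq_zero_or_pos Q with h0 | hpos
      · rw [h0]
        simpa using mul_nonneg hε.le hL.nonneg
      · have h5 : ((I.C * I.C : ℕ) : ℝ) / ε ≤ Q := hunits ▸ Nat.le_ceil _
        rw [div_le_iff₀ hε] at h5
        rw [← mul_div_assoc, div_le_iff₀ (by exact_mod_cast hpos)]
        nlinarith [hL.nonneg]
    have hval : I.consistencyLevel (I.outputPolicy τ) =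
        ∑ m ∈ Finset.range (I.C * I.C), (I.inputState ε).value m (K m (d m)) := by
      rw [I.consistencyLevel_outputPolicy ε]
      exact Finset.sum_congr rfl fun m hm => by rw [hout m (Finset.mem_range.1 hm)]
    obtain ⟨z, hz1, hz2, hz3⟩ := hL.exists_rates I.B_pos.le
    intro y hy
    obtain ⟨x, hx1, hx2, hx3⟩ := I.exists_rates ε hy
    have h5 := hz3.trans (h4 z hz1 hz2)
    have h6 := h4 x hx1 hx2
    change _ ≤ ∑ m ∈ Finset.range (I.C * I.C), _ + ((I.C * I.C : ℕ) : ℝ) * (L / Q) at h5 h6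
    rw [← hval] at h5 h6
    change ∑ m ∈ Finset.range (I.C * I.C), _ ≤ _ at h6
    rw [hx3] at h6
    -- If `L` is at most the level of `y`, the loss `ε * L` is absorbed in the comparison with `y`.
    -- Otherwise the output is compared with the best single item, which already yields at least `(1
    -- - ε) * L`.
    rcases le_total L (I.consistencyLevel y) with h7 | h7
    · nlinarith
    · nlinarith

theorem theorem2 :
    (∃ P : RealRAM.Program, IsPseudopolynomialExactAlgorithm P) ∧
      ∃ P : RealRAM.Program, IsFPTAS P :=
  ⟨⟨_, isPseudopolynomialExactAlgorithm_exactProgram⟩, ⟨_, isFPTAS_approxProgram⟩⟩
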